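/- Let $N \ge 2$ be an integer. A lower triangular real matrix $H = [h_{k,j}]_{1 \le j \le k \le N-1}$ defines the fixed-step method $$y_{k+1} = y_k - \sum_{j=0}^{k} h_{k+1,j+1}\,(y_j - \mathbb{T} y_j), \qquad k = 0, \dots, N-2,$$ for operators $\mathbb{T}\colon \mathcal{X} \to \mathcal{X}$ on a Hilbert space. Let $\mathcal{H}_\star(N-1)$ be the set of all such $H$ for which $\|y_{N-1} - \mathbb{T} y_{N-1}\|^2 \le \frac{4}{N^2}\|y_0 - y_\star\|^2$ holds for every nonexpansive $\mathbb{T}$ with a fixed point $y_\star$ and every starting point $y_0$. (For $N = 1$ the matrix is the empty $0 \times 0$ matrix $[\,\,]$.) For $m, j \ge 1$ let $$Q(m,j;H) = \sum_{j = j(1) \le i(1) < j(2) \le i(2) < \cdots < j(m) \le i(m) \le N-1}\ \prod_{r=1}^m h_{i(r),j(r)},$$ and define the H-certificates $\lambda^\star_{N,j}(H) = N\sum_{m=1}^{N-1} (-1)^{m-1} Q(m,j;H)$ for $1 \le j \le N-1$, and $\lambda^\star_{k,j}(H) = N \sum_{\ell=1}^{N-1}\sum_{m=1}^{N-1} (-1)^{\ell+m-1}\binom{\ell+m}{m}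 Q(\ell,j;H)\,Q(m,k;H)$ for $1 \le j < k \le N-1$. Put $$\rho(H) = \sum_{j=1}^{N-1}\sum_{k=j+1}^{N} \lambda^\star_{k,j}(H).$$ A matrix $H \in \mathcal{H}_\star(N-1)$ is a vertex of $\mathcal{H}_\star(N-1)$ if the number of pairs $(k,j)$, $1 \le j < k \le N$, with $\lambda^\star_{k,j}(H) = 0$ is the largest possible among all elements of $\mathcal{H}_\star(N-1)$. For $1 \le N' \le N-1$, $H_1 \in \mathcal{H}_\star(N'-1)$ and $H_2 \in \mathcal{H}_\star(N-N'-1)$, the gluing $H_1 \bowtie H_2$ is the lower triangular $(N-1)\times(N-1)$ matrix $H = [h_{k,j}]$ whose upper left $(N'-1)\times(N'-1)$ block is $H_1$, whose lower right $(N-N'-1)\times(N-N'-1)$ block is $H_2$, with $h_{k,j} = 0$ for $j < N' < k$, with $h_{N',j} = -\frac{N-N'}{N}\sum_{k=j}^{N'-1} (H_1)_{k,j}$ for $j < N'$ and $h_{N',N'} = \frac{N'(N-N')}{N}$, and with $h_{N'+1,N'}, \dots, h_{N-1,N'}$ the unique values such that $Q(k,N';H) = \frac{N'(N-N'+1)}{N(k+1)}\binom{N-N'-1}{k-1}$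 for $k = 1, \dots, N-N'$. The matrix $[\,\,]$ is basic and, recursively, every gluing of smaller basic matrices is basic. Finally, let $H_{\mathrm{OHM}}(N-1)$ be the H-matrix of the Optimal Halpern Method $y_{k+1} = \frac{1}{k+2} y_0 + \frac{k+1}{k+2}\mathbb{T} y_k$, that is, the lower triangular matrix with entries $-\frac{j}{k(k+1)}$ for $j < k$ and $\frac{k}{k+1}$ for $j = k$. Proposition. For $N \ge 2$, $$\rho(H_{\mathrm{OHM}}(N-1)) = \sum_{j=1}^{N-1} \lambda^\star_{j+1,j}(H_{\mathrm{OHM}}(N-1)) = \frac{N^2-1}{3}.$$ Moreover, $H_{\mathrm{OHM}}(N-1)$ is a basic vertex of $\mathcal{H}_\star(N-1)$, and it is the unique maximizer of $\rho$ over the set of basic vertices of $\mathcal{H}_\star(N-1)$: every basic vertex $H$ of $\mathcal{H}_\star(N-1)$ satisfies $\rho(H) \le \rho(H_{\mathrm{OHM}}(N-1))$, with equality only if $H = H_{\mathrm{OHM}}(N-1)$. -/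

import Mathlib

universe u

noncomputable section

namespace OptimalFixedPoint

/-- The entry `h_{k,j}` of an `n × n` matrix, with rows and columns numbered from `1` to `n`
(and `0` outside that range). -/
def entry {n : ℕ} (H : Matrix (Fin n) (Fin n) ℝ) (k j : ℕ) : ℝ :=
  if h : (1 ≤ k ∧ k ≤ n) ∧ (1 ≤ j ∧ j ≤ n) then
    H ⟨k - 1, by omega⟩ ⟨j - 1, by omega⟩
  else 0

/-- `H` is a lower triangular matrix. -/
def IsLowerTriangular {n : ℕ} (H : Matrix (Fin n) (Fin n) ℝ) : Prop :=
  ∀ i j : Fin n, i < j → H i j = 0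

/-- `y` follows the fixed-step method with step-size matrix `H` for the operator `T`:
`y_{k+1} = y_k - ∑_{j=0}^k h_{k+1,j+1} (y_j - T y_j)` for `k = 0, …, n-1`. -/
def Follows {X : Type u} [NormedAddCommGroup X] [InnerProductSpace ℝ X] {n : ℕ}
    (H : Matrix (Fin n) (Fin n) ℝ) (T : X → X) (y : ℕ → X) : Prop :=
  ∀ k < n, y (k + 1) =
    y k - ∑ j ∈ Finset.range (k + 1), entry H (k + 1) (j + 1) • (y j - T (y j))

/-- The set `ℋ⋆(N-1)` of lower triangular `(N-1) × (N-1)` matrices whose method satisfies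
`‖y_{N-1} - T y_{N-1}‖² ≤ 4 ‖y_0 - y⋆‖² / N²` for every nonexpansive operator `T` with a fixed
point `y⋆` on a Hilbert space. -/
def optimalSet (N : ℕ) : Set (Matrix (Fin (N - 1)) (Fin (N - 1)) ℝ) :=
  {H | IsLowerTriangular H ∧
    ∀ (X : Type u) [NormedAddCommGroup X] [InnerProductSpace ℝ X] [CompleteSpace X]
      (T : X → X), (∀ a b : X, ‖T a - T b‖ ≤ ‖a - b‖) →
      ∀ ystar : X, T ystar = ystar →
      ∀ y : ℕ → X, Follows H T y →
        ‖y (N - 1) - T (y (N - 1))‖ ^ 2 ≤ 4 * ‖y 0 - ystar‖ ^ 2 / (N : ℝ) ^ 2}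

/-- The Q-function `Q(m, j; H)` for `m, j ≥ 1`: the sum of `∏_{r=1}^m h_{i(r), j(r)}` over all
`j = j(1) ≤ i(1) < j(2) ≤ i(2) < ⋯ < j(m) ≤ i(m) ≤ n`. Here `p.1` is the sequence of row
indices `i(r)` and `p.2` the sequence of column indices `j(r)`, both numbered from `0`. -/
def Q {n : ℕ} (H : Matrix (Fin n) (Fin n) ℝ) (m j : ℕ) : ℝ :=
  ∑ p : (Fin m → Fin n) × (Fin m → Fin n) with
    (∀ r : Fin m, r.val = 0 → (p.2 r).val + 1 = j) ∧
    (∀ r : Fin m, p.2 r ≤ p.1 r) ∧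
    (∀ r s : Fin m, s.val = r.val + 1 → p.1 r < p.2 s),
    ∏ r : Fin m, H (p.1 r) (p.2 r)

/-- The H-certificate `λ⋆_{k,j}(H)`, for `1 ≤ j < k ≤ N`. -/
def certificate {N : ℕ} (H : Matrix (Fin (N - 1)) (Fin (N - 1)) ℝ) (k j : ℕ) : ℝ :=
  if k = N then
    (N : ℝ) * ∑ m ∈ Finset.Icc 1 (N - 1), (-1 : ℝ) ^ (m - 1) * Q H m j
  else
    (N : ℝ) * ∑ l ∈ Finset.Icc 1 (N - 1), ∑ m ∈ Finset.Icc 1 (N - 1),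
      (-1 : ℝ) ^ (l + m - 1) * ((l + m).choose m : ℝ) * Q H l j * Q H m k

/-- The index pairs `(k, j)`, `1 ≤ j < k ≤ N`, of the H-certificates that vanish at `H`. -/
def zeroCertificates {N : ℕ} (H : Matrix (Fin (N - 1)) (Fin (N - 1)) ℝ) : Set (ℕ × ℕ) :=
  {p | 1 ≤ p.2 ∧ p.2 < p.1 ∧ p.1 ≤ N ∧ certificate H p.1 p.2 = 0}

/-- `H` is a vertex of `ℋ⋆(N-1)`: a point of `ℋ⋆(N-1)` lying on a maximal number of the zero
sets of H-certificates (equivalently, with a minimal number of active H-certificates). -/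
def IsVertex {N : ℕ} (H : Matrix (Fin (N - 1)) (Fin (N - 1)) ℝ) : Prop :=
  H ∈ optimalSet.{u} N ∧
    ∀ H' ∈ optimalSet.{u} N, (zeroCertificates H').ncard ≤ (zeroCertificates H).ncard

/-- `H = H₁ ⋈ H₂` is the gluing of the `(N'-1) × (N'-1)` matrix `H₁` and the
`(N-N'-1) × (N-N'-1)` matrix `H₂`. -/
structure IsGluing (N N' : ℕ) (H₁ : Matrix (Fin (N' - 1)) (Fin (N' - 1)) ℝ)
    (H₂ : Matrix (Fin (N - N' - 1)) (Fin (N - N' - 1)) ℝ)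
    (H : Matrix (Fin (N - 1)) (Fin (N - 1)) ℝ) : Prop where
  lower : IsLowerTriangular H
  /-- The upper left block is `H₁`. -/
  block_left : ∀ k j, 1 ≤ k → k ≤ N' - 1 → 1 ≤ j → j ≤ N' - 1 → entry H k j = entry H₁ k j
  /-- The lower right block is `H₂`. -/
  block_right : ∀ k j, 1 ≤ k → k ≤ N - N' - 1 → 1 ≤ j → j ≤ N - N' - 1 →
    entry H (N' + k) (N' + j) = entry H₂ k j
  /-- The lower left block vanishes. -/
  block_zero : ∀ k j, N' + 1 ≤ k → k ≤ N - 1 → 1 ≤ j → j ≤ N' - 1 → entry H k j = 0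
  /-- The entries of row `N'` left of the diagonal. -/
  row : ∀ j, 1 ≤ j → j ≤ N' - 1 →
    entry H N' j = -(((N : ℝ) - N') / N) * ∑ k ∈ Finset.Icc j (N' - 1), entry H₁ k j
  /-- The diagonal entry in position `N'`. -/
  diag : entry H N' N' = (N' : ℝ) * ((N : ℝ) - N') / N
  /-- The condition that determines the entries of column `N'` below the diagonal. -/
  column : ∀ k, 1 ≤ k → k ≤ N - N' →
    Q H k N' = (N' : ℝ) * ((N : ℝ) - N' + 1) / ((N : ℝ) * ((k : ℝ) + 1)) *
      ((N - N' - 1).choose (k - 1) : ℝ)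

/-- `IsBasic N H`: the `(N-1) × (N-1)` matrix `H` is basic. The `0 × 0` matrix is basic (`N = 1`),
and every gluing of (optimal) smaller basic matrices is basic. -/
inductive IsBasic : (N : ℕ) → Matrix (Fin (N - 1)) (Fin (N - 1)) ℝ → Prop
  | empty (H : Matrix (Fin (1 - 1)) (Fin (1 - 1)) ℝ) : IsBasic 1 H
  | glue (N N' : ℕ) (hN'_pos : 1 ≤ N') (hN'_le : N' ≤ N - 1)
      (H₁ : Matrix (Fin (N' - 1)) (Fin (N' - 1)) ℝ)
      (H₂ : Matrix (Fin (N - N' - 1)) (Fin (N - N' - 1)) ℝ)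
      (H : Matrix (Fin (N - 1)) (Fin (N - 1)) ℝ)
      (opt₁ : H₁ ∈ optimalSet.{u} N') (opt₂ : H₂ ∈ optimalSet.{u} (N - N'))
      (basic₁ : IsBasic N' H₁) (basic₂ : IsBasic (N - N') H₂)
      (gluing : IsGluing N N' H₁ H₂ H) : IsBasic N H

/-- The set of basic optimal vertex algorithms in `ℋ⋆(N-1)`. -/
def basicOptimalVertices (N : ℕ) : Set (Matrix (Fin (N - 1)) (Fin (N - 1)) ℝ) :=
  {H | H ∈ optimalSet.{u} N ∧ IsVertex.{u} H ∧ IsBasic.{u} N H}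

/-- The sum `ρ(H)` of all H-certificates. -/
def rho {N : ℕ} (H : Matrix (Fin (N - 1)) (Fin (N - 1)) ℝ) : ℝ :=
  ∑ j ∈ Finset.Icc 1 (N - 1), ∑ k ∈ Finset.Icc (j + 1) N, certificate H k j

/-- The H-matrix of the Optimal Halpern Method, whose entries, numbered from `1`, are
`-j / (k (k+1))` for `j < k`, `k / (k+1)` for `j = k`, and `0` for `j > k`. -/
def ohm (N : ℕ) : Matrix (Fin (N - 1)) (Fin (N - 1)) ℝ :=
  Matrix.of fun a b =>
    let k : ℝ := (a.val : ℝ) + 1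
    let j : ℝ := (b.val : ℝ) + 1
    if b < a then -(j / (k * (k + 1))) else if b = a then k / (k + 1) else 0

end OptimalFixedPoint

end

/-!
For a step-size matrix `H` of size `N - 1` put `q_j = ∑_m Q(m, j; H) x^m` for `j < N` and `q_N = 1`,
written as polynomials in `X = 1 + x` (`colPoly`, `certPoly`). By Vandermonde's identity the powers
of `x = X - 1` have inner products `(-1)^(l+m) (l+m choose m)` with respect to the coefficient
vectors in `X`, so the H-certificates are `λ_{k,j} = -N ⟪q_j, q_k⟫` (`certificate_eq`).

Running an optimal method on the negacyclic shift of `ℝ^N` from `(1, …, 1)` shows that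
`∑_j q_j = (1 + X + ⋯ + X^(N-1)) / N` (`tailPoly_one_of_mem_optimalSet`). Hence, on the optimal set,
`2 ρ = N ∑_j ‖q_j‖² - 1`, and maximizing `ρ` means maximizing the energy `F = ∑_{j<N} ‖q_j‖²`
(`rho_eq`).

Let `H = H₁ ⋈ H₂` with `M = N - N'`. Counting chains, the columns of `H` belong to
`(N'/N) X^M q_j(H₁)` on the left, to `(N'/N) (X^M - (1 + ⋯ + X^(M-1)) / M)` in the middle and to
`q_j(H₂)` on the right. So `F(H) = (N'/N)² (F(H₁) + 1 + 1/M) + F(H₂)` (`IsGluing.energy_eq`), and by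
induction `F(H) ≤ (2N-1)(N-1)/(3N)` for basic `H`, with equality only if `M = 1` in every gluing
(`IsBasic.energy_le`). Gluing with `M = 1` throughout produces the Optimal Halpern Method, whose
`q_j` are `(j/N) X^(N-1-j) (X - 1)`; this gives its certificates (`certificate_ohm`).

It is a vertex because every optimal matrix has a nonzero certificate in each column
(`exists_certificate_ne_zero`). Indeed `q_j = (X - 1) u` with `u` in the span of the later `q_k`;
if `q_j` is orthogonal to these, then `‖X u‖ = ‖u‖` and `⟪X u, u⟫ = ‖u‖²` force `q_j = 0`, and the
degree of `∑_j q_j` drops below `N - 1`. Optimality of Halpern's method is the usual argument with the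
potential `⟪g_k, y_k - y_0⟫ + (k/2) ‖g_k‖²`, where `g_k = y_k - T y_k`.
-/

noncomputable section

namespace OptimalFixedPoint

open Polynomial Finset

variable {n : ℕ}

/-! ### Chains and generating polynomials of the Q-functions -/

theorem entry_succ (H : Matrix (Fin n) (Fin n) ℝ) (a b : Fin n) :
    entry H (a + 1) (b + 1) = H a b := by
  have ha := a.2
  have hb := b.2
  simp only [entry]
  rw [dif_pos (by omega)]
  rfl

theorem entry_of_lt (H : Matrix (Fin n) (Fin n) ℝ) {k j : ℕ} (h : n < j) :
    entry H k j = 0 := by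
  rw [entry, dif_neg (by omega)]

theorem matrix_ext_entry {H H' : Matrix (Fin n) (Fin n) ℝ}
    (h : ∀ k j, 1 ≤ k → k ≤ n → 1 ≤ j → j ≤ n → entry H k j = entry H' k j) : H = H' := by
  ext a b
  rw [← entry_succ H a b, ← entry_succ H' a b]
  exact h _ _ (by omega) (by omega) (by omega) (by omega)

theorem sum_Icc_eq_sum_fin (f : ℕ → ℝ) (s : ℕ) (hs : 1 ≤ s) :
    ∑ k ∈ Icc s n, f k = ∑ a : Fin n, if s ≤ a.val + 1 then f (a + 1) else 0 := by
  rw [Fin.sum_univ_eq_sum_range (fun a => if s ≤ a + 1 then f (a + 1) else 0) n,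
    ← Finset.sum_filter]
  refine Finset.sum_bij' (fun k _ => k - 1) (fun a _ => a + 1) ?_ ?_ ?_ ?_ ?_
  all_goals simp only [mem_Icc, mem_filter, mem_range]
  all_goals intro a ha
  · omega
  · omega
  · omega
  · omega
  · congr 1; omega

/-- The interlacing condition `j(r) ≤ i(r) < j(r+1)` on rows `a` and columns `b`. -/
def IsChain {m : ℕ} (a b : Fin m → Fin n) : Prop :=
  (∀ r, b r ≤ a r) ∧ ∀ r s : Fin m, s.val = r.val + 1 → a r < b s

open Classical in
theorem Q_eq_sum (H : Matrix (Fin n) (Fin n) ℝ) (m j : ℕ) :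
    Q H m j = ∑ a : Fin m → Fin n, ∑ b : Fin m → Fin n,
      if (∀ r : Fin m, r.val = 0 → (b r).val + 1 = j) ∧ IsChain a b then
        ∏ r, H (a r) (b r) else 0 := by
  rw [Q, Finset.sum_filter, Fintype.sum_prod_type]
  simp only [IsChain]
  refine Finset.sum_congr rfl fun a _ => Finset.sum_congr rfl fun b _ => ?_
  congr

theorem isChain_cons {m : ℕ} (a₀ b₀ : Fin n) (a b : Fin m → Fin n) :
    IsChain (Fin.cons a₀ a : Fin (m + 1) → Fin n) (Fin.cons b₀ b : Fin (m + 1) → Fin n) ↔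
      b₀ ≤ a₀ ∧ (∀ r : Fin m, r.val = 0 → a₀ < b r) ∧ IsChain a b := by
  simp only [IsChain]
  constructor
  · rintro ⟨h1, h2⟩
    refine ⟨by simpa using h1 0, fun r hr => ?_, fun r => by simpa using h1 r.succ,
      fun r s hs => ?_⟩
    · simpa using h2 0 r.succ (by simp [hr])
    · simpa using h2 r.succ s.succ (by simp [hs])
  · rintro ⟨h1, h2, h3, h4⟩
    refine ⟨fun r => ?_, fun r s hs => ?_⟩
    · refine Fin.cases ?_ (fun r => ?_) r
      · simpa using h1
      · simpa using h3 r
    · revert hs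
      refine Fin.cases ?_ (fun s => ?_) s
      · simp
      · refine Fin.cases ?_ (fun r => ?_) r
        · intro hs
          simpa using h2 s (by simpa using hs)
        · intro hs
          simpa using h4 r s (by simpa using hs)

open Classical in
/-- The sum over the columns to the right of row `i` is a sum over all chains starting there. The
empty chain counts once, whereas `Q H 0 k = 1` for every `k`; hence the case distinction. -/
theorem sum_Q_eq_sum (H : Matrix (Fin n) (Fin n) ℝ) (m : ℕ) (i : Fin n) :
    (if m = 0 then 1 else ∑ k ∈ Icc (i.val + 2) n, Q H m k) =
      ∑ a : Fin m → Fin n, ∑ b : Fin m → Fin n,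
        if (∀ r : Fin m, r.val = 0 → i < b r) ∧ IsChain a b then
          ∏ r, H (a r) (b r) else 0 := by
  cases m with
  | zero => simp [IsChain]
  | succ m =>
    simp only [Nat.add_eq_zero_iff, one_ne_zero, and_false, if_false, Q_eq_sum]
    rw [Finset.sum_comm]
    refine Finset.sum_congr rfl fun a _ => ?_
    rw [Finset.sum_comm]
    refine Finset.sum_congr rfl fun b _ => ?_
    have h0 : ∀ P : Fin n → Prop, (∀ r : Fin (m + 1), r.val = 0 → P (b r)) ↔ P (b 0) :=
      fun P => ⟨fun h => h 0 rfl, fun h r hr => by rwa [Fin.ext (a := r) (b := 0) hr]⟩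
    by_cases hc : IsChain a b
    · simp only [fun k => h0 (fun c => c.val + 1 = k), h0 (fun c => i < c), hc, and_true]
      rw [Finset.sum_ite_eq]
      congr 1
      have := (b 0).2
      simp only [mem_Icc, Fin.lt_def, eq_iff_iff]
      omega
    · simp [hc]

/-- The recursion for `Q` obtained by splitting off the first factor of each product. -/
theorem Q_succ (H : Matrix (Fin n) (Fin n) ℝ) (m j : ℕ) (hj : 1 ≤ j) :
    Q H (m + 1) j = ∑ i ∈ Icc j n, entry H i j *
      (if m = 0 then 1 else ∑ k ∈ Icc (i + 1) n, Q H m k) := by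
  classical
  -- Write the index sequences as `Fin.cons a₀ a`, `Fin.cons b₀ b`; only `b₀ + 1 = j` contributes.
  rw [sum_Icc_eq_sum_fin _ _ hj, Q_eq_sum, ← (Fin.consEquiv (fun _ => Fin n)).sum_comp,
    Fintype.sum_prod_type]
  refine Finset.sum_congr rfl fun a₀ _ => ?_
  rw [sum_Q_eq_sum]
  simp only [← (Fin.consEquiv (n := m) (fun _ => Fin n)).sum_comp (fun b => ite _ _ _),
    Fintype.sum_prod_type]
  rw [Finset.sum_comm]
  by_cases hjn : n < j
  · rw [entry_of_lt _ hjn]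
    simp only [zero_mul, ite_self]
    refine Finset.sum_eq_zero fun b₀ _ => Finset.sum_eq_zero fun a _ =>
      Finset.sum_eq_zero fun b _ => if_neg fun h => ?_
    have := h.1 0 rfl
    simp only [Fin.consEquiv, Equiv.coe_fn_mk, Fin.cons_zero] at this
    have := b₀.2
    omega
  · obtain ⟨c, rfl⟩ : ∃ c : Fin n, j = c + 1 := ⟨⟨j - 1, by omega⟩, by simp only; omega⟩
    rw [entry_succ, Finset.sum_eq_single c]
    · simp only [Finset.mul_sum]
      split_ifs with h
      · refine Finset.sum_congr rfl fun a _ => Finset.sum_congr rfl fun b _ => ?_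
        rw [mul_ite, mul_zero]
        refine if_congr ?_ ?_ rfl
        · simp only [Fin.consEquiv, Equiv.coe_fn_mk, isChain_cons]
          constructor
          · exact fun h => h.2.2
          · refine fun h' => ⟨fun r hr => ?_, by rw [Fin.le_def]; omega, h'⟩
            rw [Fin.ext (a := r) (b := 0) hr]
            simp
        · simp [Fin.consEquiv, Fin.prod_univ_succ]
      · refine Finset.sum_eq_zero fun a _ => Finset.sum_eq_zero fun b _ => if_neg fun h' => ?_
        simp only [Fin.consEquiv, Equiv.coe_fn_mk, isChain_cons] at h'
        have := h'.2.1
        rw [Fin.le_def] at this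
        omega
    · intro b₀ _ hb
      refine Finset.sum_eq_zero fun a _ => Finset.sum_eq_zero fun b _ => if_neg fun h' => hb ?_
      have := h'.1 0 rfl
      simp only [Fin.consEquiv, Equiv.coe_fn_mk, Fin.cons_zero] at this
      exact Fin.ext (by omega)
    · simp

theorem Q_eq_zero (H : Matrix (Fin n) (Fin n) ℝ) (m j : ℕ) (hj : 1 ≤ j) (h : n < m + j) :
    Q H (m + 1) j = 0 := by
  induction m generalizing j with
  | zero => rw [Q_succ _ _ _ hj, Icc_eq_empty (by omega), sum_empty]
  | succ m ih =>
    rw [Q_succ _ _ _ hj]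
    refine Finset.sum_eq_zero fun i hi => ?_
    rw [if_neg (by omega), Finset.sum_eq_zero, mul_zero]
    intro k hk
    rw [mem_Icc] at hi hk
    exact ih k (by omega) (by omega)

/-- The generating polynomial `∑_m Q(m, j; H) x^m` of the Q-functions of column `j`, in the
variable `X = 1 + x`. -/
def colPoly (H : Matrix (Fin n) (Fin n) ℝ) (j : ℕ) : ℝ[X] :=
  ∑ m ∈ Icc 1 n, C (Q H m j) * (X - 1) ^ m

/-- The sum of `1` and of the generating polynomials of the columns from `s` on. -/
def tailPoly (H : Matrix (Fin n) (Fin n) ℝ) (s : ℕ) : ℝ[X] :=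
  1 + ∑ k ∈ Icc s n, colPoly H k

theorem tailPoly_of_lt (H : Matrix (Fin n) (Fin n) ℝ) {s : ℕ} (hs : n < s) :
    tailPoly H s = 1 := by
  rw [tailPoly, Icc_eq_empty (by omega), sum_empty, add_zero]

theorem tailPoly_eq_add (H : Matrix (Fin n) (Fin n) ℝ) {s : ℕ} (hs : s ≤ n) :
    tailPoly H s = colPoly H s + tailPoly H (s + 1) := by
  rw [tailPoly, tailPoly, ← Finset.add_sum_Ioc_eq_sum_Icc hs]
  rw [show Ioc s n = Icc (s + 1) n by ext; simp only [mem_Ioc, mem_Icc]; omega]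
  ring

/-- The backward recursion for the generating polynomials. -/
theorem colPoly_eq (H : Matrix (Fin n) (Fin n) ℝ) {j : ℕ} (hj : 1 ≤ j) :
    colPoly H j = (X - 1) * ∑ i ∈ Icc j n, C (entry H i j) * tailPoly H (i + 1) := by
  -- The `m`-th summand of `tailPoly H (s + 1)`, times `X - 1`, is the `m + 1`-st one of the column.
  have key : ∀ s, 1 ≤ s → tailPoly H (s + 1) = ∑ m ∈ range n,
      C (if m = 0 then 1 else ∑ k ∈ Icc (s + 1) n, Q H m k) * (X - 1) ^ m
        + if n = 0 then 1 else 0 := by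
    intro s hs
    rcases n with _ | n
    · simp [tailPoly_of_lt]
    · rw [Finset.sum_range_succ']
      simp only [tailPoly, colPoly, if_true, Nat.add_eq_zero_iff, one_ne_zero, and_false, if_false,
        map_one, pow_zero, one_mul, add_zero]
      rw [Finset.sum_comm, add_comm]
      congr 1
      rw [Finset.range_eq_Ico, Finset.sum_Ico_add' (fun m => C (∑ k ∈ Icc (s + 1) (n + 1),
        Q H m k) * ((X : ℝ[X]) - 1) ^ m) 0 n 1]
      rw [← Finset.sum_subset (s₁ := Ico (0 + 1) (n + 1))]
      · refine Finset.sum_congr rfl fun m _ => ?_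
        rw [map_sum, Finset.sum_mul]
      · intro m; simp; omega
      -- Chains of length `n + 1` do not fit to the right of column `s ≥ 1`.
      · intro m hm hm'
        simp only [mem_Icc, mem_Ico] at hm hm'
        obtain rfl : m = n + 1 := by omega
        refine Finset.sum_eq_zero fun k hk => ?_
        rw [mem_Icc] at hk
        rw [Q_eq_zero _ _ _ (by omega) (by omega), map_zero, zero_mul]
  rw [Finset.sum_congr rfl fun i hi => by rw [key i (by rw [mem_Icc] at hi; omega)]]
  rcases Nat.eq_zero_or_pos n with h0 | h0
  · subst h0
    rw [colPoly, Icc_eq_empty (a := j) (by omega)]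
    simp
  · simp only [h0.ne', if_false, add_zero, Finset.mul_sum]
    rw [Finset.sum_comm, colPoly]
    have : Icc 1 n = Ico (0 + 1) (n + 1) := by ext; simp only [mem_Ico, mem_Icc]; omega
    rw [this, ← Finset.sum_Ico_add' (fun m => C (Q H m j) * ((X : ℝ[X]) - 1) ^ m) 0 n 1,
      ← Finset.range_eq_Ico]
    refine Finset.sum_congr rfl fun m _ => ?_
    rw [Q_succ _ _ _ hj, map_sum, Finset.sum_mul]
    refine Finset.sum_congr rfl fun i _ => ?_
    rw [map_mul]
    ring

theorem coeff_colPoly_of_le (H : Matrix (Fin n) (Fin n) ℝ) (j : ℕ) {i : ℕ} (hi : n < i) :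
    (colPoly H j).coeff i = 0 := by
  rw [colPoly, finsetSum_coeff]
  refine Finset.sum_eq_zero fun m hm => ?_
  rw [mem_Icc] at hm
  rw [coeff_C_mul, coeff_eq_zero_of_natDegree_lt, mul_zero]
  have : ((X : ℝ[X]) - 1).natDegree = 1 := natDegree_X_sub_C 1
  rw [natDegree_pow, this]
  omega

/-! ### Optimality fixes the sum of the generating polynomials -/

/-- The polynomial `V_k` such that `y_k = V_k(T) y_0` along the method, for linear `T`. -/
def forwardPoly (H : Matrix (Fin n) (Fin n) ℝ) : ℕ → ℝ[X]
  | 0 => 1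
  | k + 1 => forwardPoly H k +
      (X - 1) * ∑ j : Fin (k + 1), C (entry H (k + 1) (j + 1)) * forwardPoly H j

theorem forwardPoly_succ (H : Matrix (Fin n) (Fin n) ℝ) (k : ℕ) :
    forwardPoly H (k + 1) = forwardPoly H k +
      (X - 1) * ∑ j ∈ range (k + 1), C (entry H (k + 1) (j + 1)) * forwardPoly H j := by
  rw [forwardPoly, Finset.sum_range]

/-- The forward and the backward recursion have the same outcome: both sum over all chains. -/
theorem forwardPoly_eq_tailPoly (H : Matrix (Fin n) (Fin n) ℝ) :
    forwardPoly H n = tailPoly H 1 := by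
  -- Both sides equal `∑ h_{k,j} (X - 1) V_{j-1} U_{k+1}` over `j ≤ k`, with `U = tailPoly H`;
  -- summation by parts turns this into `V_n U_{n+1} = V_0 U_1`.
  have h1 : ∑ k ∈ range n, (forwardPoly H (k + 1) - forwardPoly H k) * tailPoly H (k + 2) =
      ∑ j ∈ range n, forwardPoly H j * (tailPoly H (j + 1) - tailPoly H (j + 2)) := by
    have hl : ∀ k ∈ range n, (forwardPoly H (k + 1) - forwardPoly H k) * tailPoly H (k + 2) =
        ∑ j ∈ range n, if j ≤ k then (X - 1) * (C (entry H (k + 1) (j + 1)) * forwardPoly H j *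
          tailPoly H (k + 2)) else 0 := by
      intro k hk
      rw [mem_range] at hk
      rw [forwardPoly_succ, add_sub_cancel_left, mul_assoc, Finset.sum_mul, Finset.mul_sum,
        ← Finset.sum_filter]
      refine Finset.sum_congr ?_ fun _ _ => rfl
      ext j
      simp only [mem_range, mem_filter]
      omega
    have hr : ∀ j ∈ range n, forwardPoly H j * (tailPoly H (j + 1) - tailPoly H (j + 2)) =
        ∑ k ∈ range n, if j ≤ k then (X - 1) * (C (entry H (k + 1) (j + 1)) * forwardPoly H j *
          tailPoly H (k + 2)) else 0 := by
      intro j hj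
      rw [mem_range] at hj
      rw [tailPoly_eq_add H (s := j + 1) (by omega), add_sub_cancel_right,
        colPoly_eq H (by omega), ← Finset.sum_filter]
      have : Icc (j + 1) n = ((range n).filter (j ≤ ·)).map (addRightEmbedding 1) := by
        ext i
        simp only [mem_Icc, mem_map, mem_filter, mem_range, addRightEmbedding_apply]
        exact ⟨fun h => ⟨i - 1, by omega, by omega⟩, fun ⟨a, h⟩ => by omega⟩
      rw [this, Finset.sum_map, Finset.mul_sum, Finset.mul_sum]
      refine Finset.sum_congr rfl fun k _ => ?_
      simp only [addRightEmbedding_apply]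
      ring
    rw [Finset.sum_congr rfl hl, Finset.sum_congr rfl hr, Finset.sum_comm]
  have h2 : ∑ k ∈ range n, (forwardPoly H (k + 1) * tailPoly H (k + 2) -
      forwardPoly H k * tailPoly H (k + 1)) = 0 := by
    rw [← sub_eq_zero, ← Finset.sum_sub_distrib] at h1
    rw [← h1]
    exact Finset.sum_congr rfl fun k _ => by ring
  rw [Finset.sum_range_sub (fun k => forwardPoly H k * tailPoly H (k + 1)),
    tailPoly_of_lt H (by omega), forwardPoly, sub_eq_zero] at h2
  simpa using h2

theorem natDegree_forwardPoly_le (H : Matrix (Fin n) (Fin n) ℝ) (k : ℕ) :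
    (forwardPoly H k).natDegree ≤ k := by
  induction k using Nat.strong_induction_on with
  | _ k ih =>
    rcases k with _ | k
    · simp [forwardPoly]
    · rw [forwardPoly_succ]
      refine natDegree_add_le_of_degree_le ((ih k (by omega)).trans (by omega)) ?_
      refine natDegree_mul_le.trans ?_
      rw [show ((X : ℝ[X]) - 1).natDegree = 1 from natDegree_X_sub_C 1, add_comm]
      refine Nat.add_le_add_right (natDegree_sum_le_of_forall_le _ _ fun j hj => ?_) 1
      rw [mem_range] at hj
      exact (natDegree_C_mul_le _ _).trans ((ih j hj).trans (by omega))

theorem eval_one_forwardPoly (H : Matrix (Fin n) (Fin n) ℝ) (k : ℕ) :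
    (forwardPoly H k).eval 1 = 1 := by
  induction k with
  | zero => simp [forwardPoly]
  | succ k ih => simp [forwardPoly_succ, ih]

theorem follows_linear {Y : Type u} [NormedAddCommGroup Y] [InnerProductSpace ℝ Y]
    (H : Matrix (Fin n) (Fin n) ℝ) (T : Y →ₗ[ℝ] Y) (v : Y) :
    Follows H T fun k => aeval T (forwardPoly H k) v := by
  intro k _
  simp only [forwardPoly_succ, map_add, map_mul, map_sub, map_one, aeval_X, map_sum, aeval_C,
    LinearMap.add_apply, Module.End.mul_apply, LinearMap.sub_apply, LinearMap.sum_apply,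
    Module.End.one_apply, Module.algebraMap_end_apply, smul_sub, Finset.sum_sub_distrib, map_smul]
  abel

/-- The cyclic shift with a sign change on `ℝⁿ⁺¹`: an isometry with `T ^ (n + 1) = -1`. The index
type is lifted so that the space lies in the universe over which `optimalSet` quantifies. -/
def negacyclicShift (n : ℕ) :
    EuclideanSpace ℝ (ULift.{u} (Fin (n + 1))) →ₗ[ℝ]
      EuclideanSpace ℝ (ULift.{u} (Fin (n + 1))) where
  toFun a := WithLp.toLp 2 fun i =>
    (Fin.cons (-a ⟨Fin.last n⟩) fun i : Fin n => a ⟨i.castSucc⟩ : Fin (n + 1) → ℝ) i.down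
  map_add' a b := by
    ext ⟨i⟩
    refine Fin.cases ?_ (fun i => ?_) i
    · simp only [Fin.cons_zero, PiLp.add_apply]
      ring
    · simp
  map_smul' c a := by
    ext ⟨i⟩
    refine Fin.cases ?_ (fun i => ?_) i <;> simp

theorem negacyclicShift_zero (a : EuclideanSpace ℝ (ULift.{u} (Fin (n + 1)))) :
    negacyclicShift n a ⟨0⟩ = -a ⟨Fin.last n⟩ := rfl

theorem negacyclicShift_succ (a : EuclideanSpace ℝ (ULift.{u} (Fin (n + 1)))) (i : Fin n) :
    negacyclicShift n a ⟨i.succ⟩ = a ⟨i.castSucc⟩ := rfl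

theorem norm_sq_ulift (a : EuclideanSpace ℝ (ULift.{u} (Fin n))) :
    ‖a‖ ^ 2 = ∑ i : Fin n, a ⟨i⟩ ^ 2 := by
  rw [EuclideanSpace.real_norm_sq_eq]
  exact Fintype.sum_equiv Equiv.ulift _ _ fun i => rfl

theorem norm_negacyclicShift (a : EuclideanSpace ℝ (ULift.{u} (Fin (n + 1)))) :
    ‖negacyclicShift n a‖ = ‖a‖ := by
  rw [← sq_eq_sq₀ (norm_nonneg _) (norm_nonneg _), norm_sq_ulift, norm_sq_ulift,
    Fin.sum_univ_succ, Fin.sum_univ_castSucc]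
  simp only [negacyclicShift_zero, negacyclicShift_succ, neg_sq]
  ring

/-- `Tᵏ (1, …, 1)` has its first `k` entries equal to `-1`. -/
theorem negacyclicShift_pow (n k : ℕ) (hk : k ≤ n + 1) (i : Fin (n + 1)) :
    ((negacyclicShift.{u} n ^ k) (WithLp.toLp 2 fun _ => 1)) ⟨i⟩ =
      if i.val < k then -1 else 1 := by
  induction k generalizing i with
  | zero => simp
  | succ k ih =>
    rw [pow_succ', Module.End.mul_apply]
    refine Fin.cases ?_ (fun i => ?_) i
    · rw [negacyclicShift_zero, ih (by omega), if_neg (by rw [Fin.val_last]; omega),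
        if_pos (by simp)]
    · rw [negacyclicShift_succ, ih (by omega)]
      simp

/-- Optimality determines the sum of all generating polynomials. For the negacyclic shift `T` and
`y_0 = (1, …, 1)`, the residual is twice the vector of coefficients of `V_{N-1}`; these add up to
`1`, and the optimal bound leaves only the constant vector. -/
theorem tailPoly_one_of_mem_optimalSet {N : ℕ} (hN : 1 ≤ N)
    {H : Matrix (Fin (N - 1)) (Fin (N - 1)) ℝ} (hH : H ∈ optimalSet.{u} N) :
    tailPoly H 1 = C ((N : ℝ)⁻¹) * ∑ i ∈ range N, X ^ i := by
  obtain ⟨n, rfl⟩ : ∃ n, N = n + 1 := ⟨N - 1, by omega⟩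
  change Matrix (Fin n) (Fin n) ℝ at H
  rw [← forwardPoly_eq_tailPoly H]
  set p := forwardPoly H n with hp
  have hdeg : p.natDegree < n + 1 := Nat.lt_succ_of_le (natDegree_forwardPoly_le H n)
  have hsum : ∑ i ∈ range (n + 1), p.coeff i = 1 := by
    have := eval_one_forwardPoly H n
    rw [← hp, eval_eq_sum_range' hdeg] at this
    simpa using this
  set T := negacyclicShift.{u} n
  set v : EuclideanSpace ℝ (ULift.{u} (Fin (n + 1))) := WithLp.toLp 2 fun _ => 1 with hv
  -- `(1 - T) Tᵏ v` is twice the `k`-th unit vector.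
  have hres : ∀ i : Fin (n + 1), (aeval T p v - T (aeval T p v)) ⟨i⟩ = 2 * p.coeff i := by
    intro i
    have h1 : aeval T p v - T (aeval T p v) =
        ∑ k ∈ range (n + 1), p.coeff k • ((T ^ k) v - (T ^ (k + 1)) v) := by
      rw [aeval_eq_sum_range' hdeg]
      simp [LinearMap.sum_apply, smul_sub, pow_succ', Finset.sum_sub_distrib]
    rw [h1, WithLp.ofLp_sum, Finset.sum_apply, Finset.sum_eq_single i.val]
    · have h2 := negacyclicShift_pow.{u} n i (by omega) i
      have h3 := negacyclicShift_pow.{u} n (i + 1) (by omega) i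
      rw [if_neg (by omega)] at h2
      rw [if_pos (by omega)] at h3
      simp only [PiLp.smul_apply, PiLp.sub_apply, smul_eq_mul, T, hv]
      rw [h2, h3]
      ring
    · intro k hk hki
      rw [mem_range] at hk
      have h2 := negacyclicShift_pow.{u} n k (by omega) i
      have h3 := negacyclicShift_pow.{u} n (k + 1) (by omega) i
      simp only [PiLp.smul_apply, PiLp.sub_apply, smul_eq_mul, T, hv]
      rw [h2, h3]
      by_cases h : i.val < k
      · rw [if_pos h, if_pos (by omega)]; ring
      · rw [if_neg h, if_neg (by omega)]; ring
    · intro h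
      exact absurd (mem_range.2 i.2) h
  have hopt := hH.2 (EuclideanSpace ℝ (ULift.{u} (Fin (n + 1)))) T
    (fun a b => by rw [← map_sub, norm_negacyclicShift]) 0 (map_zero _) _ (follows_linear H T v)
  change ‖aeval T p v - T (aeval T p v)‖ ^ 2 ≤ _ at hopt
  rw [norm_sq_ulift] at hopt
  simp only [hres] at hopt
  have hv0 : ‖aeval T (forwardPoly H 0) v - 0‖ ^ 2 = (n : ℝ) + 1 := by
    rw [sub_zero, forwardPoly, map_one, Module.End.one_apply, norm_sq_ulift]
    simp [hv]
  rw [hv0, Fin.sum_univ_eq_sum_range (fun i => (2 * p.coeff i) ^ 2)] at hopt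
  have hpos : (0 : ℝ) < (n : ℝ) + 1 := by positivity
  -- The coefficients have sum `1` and sum of squares at most `1 / (n + 1)`.
  have hzero : ∑ i ∈ range (n + 1), (p.coeff i - ((n : ℝ) + 1)⁻¹) ^ 2 ≤ 0 := by
    have : ∑ i ∈ range (n + 1), (p.coeff i - ((n : ℝ) + 1)⁻¹) ^ 2 =
        4⁻¹ * ∑ i ∈ range (n + 1), (2 * p.coeff i) ^ 2 - ((n : ℝ) + 1)⁻¹ := by
      have h2 : ∀ i, (p.coeff i - ((n : ℝ) + 1)⁻¹) ^ 2 = 4⁻¹ * (2 * p.coeff i) ^ 2 -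
          2 * ((n : ℝ) + 1)⁻¹ * p.coeff i + ((n : ℝ) + 1)⁻¹ ^ 2 := fun i => by ring
      simp only [h2, Finset.sum_add_distrib, Finset.sum_sub_distrib, ← Finset.mul_sum, hsum,
        Finset.sum_const, card_range, nsmul_eq_mul]
      push_cast
      field_simp
      ring
    rw [this]
    push_cast at hopt
    have h3 : 4 * ((n : ℝ) + 1) / ((n : ℝ) + 1) ^ 2 = 4 * ((n : ℝ) + 1)⁻¹ := by field_simp
    rw [h3] at hopt
    linarith
  have hall := (Finset.sum_eq_zero_iff_of_nonneg fun i _ => sq_nonneg _).1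
    (le_antisymm hzero (Finset.sum_nonneg fun i _ => sq_nonneg _))
  rw [Polynomial.as_sum_range' p (n + 1) hdeg, Finset.mul_sum]
  refine Finset.sum_congr rfl fun i hi => ?_
  have := pow_eq_zero_iff (two_ne_zero) |>.1 (hall i hi)
  rw [← C_mul_X_pow_eq_monomial, sub_eq_zero.1 this]
  push_cast
  rfl

/-! ### Certificates as inner products -/

/-- The polynomials entering the certificates: `colPoly H j` for `j < N`, and `1` for `j = N`. -/
def certPoly {N : ℕ} (H : Matrix (Fin (N - 1)) (Fin (N - 1)) ℝ) (j : ℕ) : ℝ[X] :=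
  if j = N then 1 else colPoly H j

theorem coeff_X_sub_one_pow (m i : ℕ) :
    (((X : ℝ[X]) - 1) ^ m).coeff i = (-1) ^ (m + i) * (m.choose i : ℝ) := by
  have h : ((X : ℝ[X]) - 1) = X + C (-1) := by simp [sub_eq_add_neg]
  rw [h, coeff_X_add_C_pow]
  rcases le_or_gt i m with hi | hi
  · congr 1
    obtain ⟨k, rfl⟩ := Nat.exists_eq_add_of_le hi
    rw [Nat.add_sub_cancel_left, show i + k + i = 2 * i + k by ring, pow_add, pow_mul]
    simp
  · simp [Nat.choose_eq_zero_of_lt hi]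

/-- The powers of `X - 1` have the Gram matrix that occurs in the H-certificates, for the inner
product of coefficient vectors. This is Vandermonde's identity. -/
theorem sum_coeff_X_sub_one_pow (N l m : ℕ) (hm : m < N) :
    ∑ i ∈ range N, (((X : ℝ[X]) - 1) ^ l).coeff i * (((X : ℝ[X]) - 1) ^ m).coeff i =
      (-1) ^ (l + m) * ((l + m).choose m : ℝ) := by
  rw [Nat.add_choose_eq, Finset.Nat.sum_antidiagonal_eq_sum_range_succ
    (fun i j => l.choose i * m.choose j) m]
  push_cast
  rw [Finset.mul_sum, ← Finset.sum_subset (Finset.range_subset_range.2 (Nat.succ_le_of_lt hm))]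
  · refine Finset.sum_congr rfl fun i hi => ?_
    rw [mem_range, Nat.lt_succ_iff] at hi
    rw [coeff_X_sub_one_pow, coeff_X_sub_one_pow, Nat.choose_symm hi, pow_add, pow_add, pow_add]
    have : ((-1 : ℝ) ^ i) * (-1) ^ i = 1 := by rw [← mul_pow]; simp
    linear_combination ((-1 : ℝ) ^ l * (-1) ^ m * (l.choose i * m.choose i)) * this
  · intro i _ hi
    rw [mem_range] at hi
    rw [coeff_X_sub_one_pow m, Nat.choose_eq_zero_of_lt (by omega)]
    simp

theorem sum_coeff_colPoly {N : ℕ} (H : Matrix (Fin (N - 1)) (Fin (N - 1)) ℝ) (j : ℕ)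
    (f : ℝ[X]) :
    ∑ i ∈ range N, (colPoly H j).coeff i * f.coeff i = ∑ l ∈ Icc 1 (N - 1),
      Q H l j * ∑ i ∈ range N, (((X : ℝ[X]) - 1) ^ l).coeff i * f.coeff i := by
  simp only [colPoly, finsetSum_coeff, coeff_C_mul, Finset.sum_mul, Finset.mul_sum]
  rw [Finset.sum_comm]
  simp only [mul_assoc]

/-- The H-certificates are, up to the factor `-N`, the mutual inner products of the coefficient
vectors of the polynomials `certPoly H j`. -/
theorem certificate_eq {N : ℕ} (H : Matrix (Fin (N - 1)) (Fin (N - 1)) ℝ) {k j : ℕ}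
    (hjk : j < k) (hk : k ≤ N) :
    certificate H k j = -N * ∑ i ∈ range N, (certPoly H j).coeff i * (certPoly H k).coeff i := by
  rw [certPoly, if_neg (by omega : j ≠ N), certPoly, certificate, sum_coeff_colPoly]
  have hsign : ∀ l, 1 ≤ l → (-1 : ℝ) ^ (l - 1) = -(-1) ^ l := by
    intro l hl
    obtain ⟨l, rfl⟩ := Nat.exists_eq_add_of_le' hl
    simp [pow_succ]
  split_ifs with hkN
  · rw [neg_mul, ← mul_neg, ← Finset.sum_neg_distrib]
    congr 1
    refine Finset.sum_congr rfl fun l hl => ?_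
    have := sum_coeff_X_sub_one_pow N l 0 (by omega)
    rw [pow_zero] at this
    rw [this, hsign l (mem_Icc.1 hl).1]
    simp
    ring
  · rw [neg_mul, ← mul_neg, ← Finset.sum_neg_distrib]
    congr 1
    refine Finset.sum_congr rfl fun l hl => ?_
    have : ∑ i ∈ range N, (((X : ℝ[X]) - 1) ^ l).coeff i * (colPoly H k).coeff i =
        ∑ m ∈ Icc 1 (N - 1), Q H m k * ((-1) ^ (l + m) * ((l + m).choose m : ℝ)) := by
      simp only [mul_comm (coeff (((X : ℝ[X]) - 1) ^ l) _)]
      rw [sum_coeff_colPoly]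
      refine Finset.sum_congr rfl fun m hm => ?_
      rw [mem_Icc] at hm
      rw [← sum_coeff_X_sub_one_pow N l m (by omega)]
      simp only [mul_comm]
    rw [this, Finset.mul_sum, ← Finset.sum_neg_distrib]
    refine Finset.sum_congr rfl fun m hm => ?_
    rw [mem_Icc] at hl
    rw [hsign (l + m) (by omega)]
    ring

theorem two_mul_sum_pairs (N : ℕ) (hN : 1 ≤ N) (a : ℕ → ℝ) :
    2 * ∑ j ∈ Icc 1 (N - 1), ∑ k ∈ Icc (j + 1) N, a j * a k =
      (∑ j ∈ Icc 1 N, a j) ^ 2 - ∑ j ∈ Icc 1 N, a j ^ 2 := by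
  obtain ⟨n, rfl⟩ : ∃ n, N = n + 1 := ⟨N - 1, by omega⟩
  rw [Nat.add_sub_cancel]
  clear hN
  induction n with
  | zero => simp
  | succ n ih =>
    have h : ∀ j ∈ Icc 1 (n + 1), ∑ k ∈ Icc (j + 1) (n + 1 + 1), a j * a k =
        ∑ k ∈ Icc (j + 1) (n + 1), a j * a k + a j * a (n + 1 + 1) := fun j hj => by
      rw [Finset.sum_Icc_succ_top (by rw [mem_Icc] at hj; omega)]
    rw [Finset.sum_congr rfl h, Finset.sum_add_distrib, ← Finset.sum_mul,
      Finset.sum_Icc_succ_top (b := n) (by omega) (fun j => ∑ k ∈ Icc (j + 1) (n + 1), a j * a k),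
      Icc_eq_empty (a := n + 1 + 1) (b := n + 1) (by omega), sum_empty, add_zero,
      Finset.sum_Icc_succ_top (b := n + 1) (by omega) a,
      Finset.sum_Icc_succ_top (b := n + 1) (by omega) (fun j => a j ^ 2)]
    linear_combination ih

/-- The squared coefficient norms of the generating polynomials of all columns, added up. -/
def energy {N : ℕ} (H : Matrix (Fin (N - 1)) (Fin (N - 1)) ℝ) : ℝ :=
  ∑ j ∈ Icc 1 (N - 1), ∑ i ∈ range N, (colPoly H j).coeff i ^ 2

theorem sum_certPoly {N : ℕ} (hN : 1 ≤ N) (H : Matrix (Fin (N - 1)) (Fin (N - 1)) ℝ) :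
    ∑ j ∈ Icc 1 N, certPoly H j = tailPoly H 1 := by
  obtain ⟨n, rfl⟩ : ∃ n, N = n + 1 := ⟨N - 1, by omega⟩
  rw [Finset.sum_Icc_succ_top (by omega), tailPoly, add_comm, certPoly, if_pos rfl]
  congr 1
  refine Finset.sum_congr rfl fun j hj => ?_
  rw [mem_Icc] at hj
  rw [certPoly, if_neg (by omega)]

/-- On the optimal set, `ρ` is an increasing affine function of the energy: twice the sum of the
mutual inner products is the squared norm of the sum, which optimality fixes, minus the energy. -/
theorem rho_eq {N : ℕ} (hN : 1 ≤ N) {H : Matrix (Fin (N - 1)) (Fin (N - 1)) ℝ}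
    (hH : H ∈ optimalSet.{u} N) : rho H = (N * (energy H + 1) - 1) / 2 := by
  have hN' : (N : ℝ) ≠ 0 := by positivity
  have h1 : rho H = -N * ∑ i ∈ range N, ∑ j ∈ Icc 1 (N - 1), ∑ k ∈ Icc (j + 1) N,
      (certPoly H j).coeff i * (certPoly H k).coeff i := by
    rw [rho, Finset.sum_comm (s := range N), Finset.mul_sum]
    refine Finset.sum_congr rfl fun j _ => ?_
    rw [Finset.sum_comm (s := range N), Finset.mul_sum]
    refine Finset.sum_congr rfl fun k hk => ?_
    rw [mem_Icc] at hk
    exact certificate_eq H (by omega) hk.2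
  have h2 : ∀ i ∈ range N, 2 * ∑ j ∈ Icc 1 (N - 1), ∑ k ∈ Icc (j + 1) N,
      (certPoly H j).coeff i * (certPoly H k).coeff i =
      ((N : ℝ)⁻¹) ^ 2 - ∑ j ∈ Icc 1 N, (certPoly H j).coeff i ^ 2 := by
    intro i hi
    rw [two_mul_sum_pairs N hN fun j => (certPoly H j).coeff i, ← finsetSum_coeff,
      sum_certPoly hN, tailPoly_one_of_mem_optimalSet hN hH, coeff_C_mul, finsetSum_coeff]
    simp only [coeff_X_pow]
    rw [Finset.sum_ite_eq, if_pos hi, mul_one]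
  have h3 : ∑ i ∈ range N, ∑ j ∈ Icc 1 N, (certPoly H j).coeff i ^ 2 = energy H + 1 := by
    rw [Finset.sum_comm]
    obtain ⟨n, rfl⟩ : ∃ n, N = n + 1 := ⟨N - 1, by omega⟩
    rw [Finset.sum_Icc_succ_top (by omega), energy]
    congr 1
    · refine Finset.sum_congr rfl fun j hj => ?_
      rw [mem_Icc] at hj
      rw [certPoly, if_neg (by omega)]
    · rw [certPoly, if_pos rfl, Finset.sum_eq_single 0] <;> simp +contextual [coeff_one]
  have h4 := Finset.sum_congr rfl h2
  rw [← Finset.mul_sum, Finset.sum_sub_distrib, h3, Finset.sum_const, card_range,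
    nsmul_eq_mul] at h4
  have h5 : (N : ℝ) * ((N : ℝ) * (N : ℝ)⁻¹ ^ 2) = 1 := by field_simp
  rw [h1]
  linear_combination (-(N : ℝ) / 2) * h4 - 1 / 2 * h5

/-! ### Generating polynomials of a gluing -/

theorem geom_sum_eq_sum_X_sub_one_pow (M : ℕ) :
    ∑ i ∈ range M, (X : ℝ[X]) ^ i =
      ∑ m ∈ range M, C (M.choose (m + 1) : ℝ) * ((X : ℝ[X]) - 1) ^ m := by
  have h := congrArg (fun p : ℝ[X] => p.comp (X - 1)) (geom_sum_X_comp_X_add_one_eq_sum (R := ℝ) M)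
  simpa [comp_assoc, Polynomial.sum_comp] using h

theorem X_pow_eq_sum_X_sub_one_pow (M : ℕ) :
    (X : ℝ[X]) ^ M = ∑ m ∈ range (M + 1), C (M.choose m : ℝ) * ((X : ℝ[X]) - 1) ^ m := by
  conv_lhs => rw [← sub_add_cancel (X : ℝ[X]) 1, add_pow]
  refine Finset.sum_congr rfl fun m _ => ?_
  simp [mul_comm]

theorem choose_sub_choose_div {M m : ℕ} (hm : 1 ≤ m) (hmM : m ≤ M) :
    (M.choose m : ℝ) - (M : ℝ)⁻¹ * (M.choose (m + 1) : ℝ) =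
      ((M : ℝ) + 1) / ((m : ℝ) + 1) * ((M - 1).choose (m - 1) : ℝ) := by
  obtain ⟨a, rfl⟩ := Nat.exists_eq_add_of_le' hm
  obtain ⟨b, rfl⟩ := Nat.exists_eq_add_of_le' (hm.trans hmM)
  simp only [Nat.add_sub_cancel]
  have h1 : ((b : ℝ) + 1) * (b.choose a : ℝ) = ((b + 1).choose (a + 1) : ℝ) * (a + 1) := by
    exact_mod_cast Nat.add_one_mul_choose_eq b a
  have h2 : ((b + 1).choose (a + 1 + 1) : ℝ) * (a + 1 + 1) =
      ((b + 1).choose (a + 1) : ℝ) * (b - a) := by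
    have := Nat.choose_succ_right_eq (b + 1) (a + 1)
    rw [show b + 1 - (a + 1) = b - a by omega] at this
    have h3 := congrArg (Nat.cast (R := ℝ)) this
    push_cast [Nat.cast_sub (show a ≤ b by omega)] at h3
    exact h3
  push_cast
  have hb : (b : ℝ) + 1 ≠ 0 := by positivity
  have ha : (a : ℝ) + 1 + 1 ≠ 0 := by positivity
  field_simp
  linear_combination (-1 : ℝ) * h2 - (b + 1 + 1 : ℝ) * h1

namespace IsGluing

variable {N K : ℕ} {H₁ : Matrix (Fin (K - 1)) (Fin (K - 1)) ℝ}
  {H₂ : Matrix (Fin (N - K - 1)) (Fin (N - K - 1)) ℝ} {H : Matrix (Fin (N - 1)) (Fin (N - 1)) ℝ}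

theorem colPoly_right_of_tailPoly (h : IsGluing N K H₁ H₂ H) {s : ℕ} (hs : 1 ≤ s)
    (ih : ∀ t, s < t → tailPoly H (K + t) = tailPoly H₂ t) :
    colPoly H (K + s) = colPoly H₂ s := by
  rw [colPoly_eq H (by omega), colPoly_eq H₂ hs]
  refine congrArg (fun p : ℝ[X] => (X - 1) * p) ?_
  refine Finset.sum_bij' (fun i _ => i - K) (fun i _ => K + i) ?_ ?_ ?_ ?_ ?_
  all_goals simp only [mem_Icc]
  all_goals intro i hi
  · omega
  · omega
  · omega
  · omega
  · obtain ⟨k, rfl⟩ := Nat.exists_eq_add_of_le (show K ≤ i by omega)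
    rw [h.block_right k s (by omega) (by omega) (by omega) (by omega), Nat.add_sub_cancel_left,
      add_assoc, ih _ (by omega)]

theorem tailPoly_right (h : IsGluing N K H₁ H₂ H) (hKN : K ≤ N - 1) {s : ℕ} (hs : 1 ≤ s) :
    tailPoly H (K + s) = tailPoly H₂ s := by
  obtain ⟨d, hd⟩ : ∃ d, N - K ≤ s + d := ⟨N, by omega⟩
  induction d using Nat.strong_induction_on generalizing s with
  | _ d ih =>
    rcases lt_or_ge (N - K - 1) s with hlt | hle
    · rw [tailPoly_of_lt H₂ hlt, tailPoly_of_lt H (by omega)]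
    · have ih' : ∀ t, s < t → tailPoly H (K + t) = tailPoly H₂ t := fun t ht =>
        ih (d - 1) (by omega) (by omega) (by omega)
      rw [tailPoly_eq_add H (by omega), tailPoly_eq_add H₂ hle,
        h.colPoly_right_of_tailPoly hs ih', add_assoc, ih' _ (by omega)]

theorem colPoly_right (h : IsGluing N K H₁ H₂ H) (hKN : K ≤ N - 1) {s : ℕ} (hs : 1 ≤ s) :
    colPoly H (K + s) = colPoly H₂ s :=
  h.colPoly_right_of_tailPoly hs fun _ ht => h.tailPoly_right hKN (by omega)

/-- The generating polynomial that the column condition of a gluing prescribes. -/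
theorem colPoly_middle (h : IsGluing N K H₁ H₂ H) (hK : 1 ≤ K) (hKN : K ≤ N - 1) :
    colPoly H K = C ((K : ℝ) / N) *
      (X ^ (N - K) - C (((N - K : ℕ) : ℝ)⁻¹) * ∑ i ∈ range (N - K), X ^ i) := by
  have hcast : ((N - K : ℕ) : ℝ) = (N : ℝ) - K := by rw [Nat.cast_sub (by omega)]
  have hM : ((N - K : ℕ) : ℝ) ≠ 0 := Nat.cast_ne_zero.2 (by omega)
  have hR : X ^ (N - K) - C (((N - K : ℕ) : ℝ)⁻¹) * ∑ i ∈ range (N - K), X ^ i =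
      ∑ m ∈ range (N - K + 1), C (((N - K).choose m : ℝ) -
        ((N - K : ℕ) : ℝ)⁻¹ * ((N - K).choose (m + 1) : ℝ)) * ((X : ℝ[X]) - 1) ^ m := by
    rw [geom_sum_eq_sum_X_sub_one_pow, X_pow_eq_sum_X_sub_one_pow, Finset.mul_sum]
    simp only [map_sub, sub_mul, Finset.sum_sub_distrib, map_mul, mul_assoc]
    congr 1
    rw [Finset.sum_range_succ _ (N - K), Nat.choose_succ_self]
    simp
  rw [hR, Finset.sum_range_succ', Nat.choose_one_right, inv_mul_cancel₀ hM]
  simp only [Nat.choose_zero_right, Nat.cast_one, sub_self, map_zero, zero_mul, add_zero]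
  rw [colPoly, ← Finset.sum_subset (s₁ := Icc 1 (N - K))]
  · have : Icc 1 (N - K) = Ico (0 + 1) (N - K + 1) := by
      ext
      simp only [mem_Icc, mem_Ico]
      omega
    rw [this, ← Finset.sum_Ico_add' (fun m => C (Q H m K) * ((X : ℝ[X]) - 1) ^ m) 0 (N - K) 1,
      ← Finset.range_eq_Ico, Finset.mul_sum]
    refine Finset.sum_congr rfl fun m hm => ?_
    rw [mem_range] at hm
    rw [h.column (m + 1) (by omega) (by omega), choose_sub_choose_div (by omega) (by omega),
      ← mul_assoc, ← C_mul, hcast]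
    congr 2
    push_cast
    field_simp
  · intro m
    simp only [mem_Icc]
    omega
  · intro m hm hm'
    rw [mem_Icc] at hm hm'
    obtain ⟨m, rfl⟩ := Nat.exists_eq_add_of_le' hm.1
    rw [Q_eq_zero H m K hK (by omega), map_zero, zero_mul]

/-- Left of the glued column the chains of `H₁` are continued, with total weight
`(K / N) X ^ (N - K)`: they leave the block of `H₁` into row `K`, into column `K`, or directly
into the block of `H₂`. -/
theorem colPoly_left_of_tailPoly (h : IsGluing N K H₁ H₂ H) (hKN : K ≤ N - 1)
    (opt₂ : H₂ ∈ optimalSet.{u} (N - K)) {s : ℕ} (hs : 1 ≤ s) (hsK : s < K)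
    (ih : ∀ t, s < t → t ≤ K → tailPoly H t =
      tailPoly H K + C ((K : ℝ) / N) * X ^ (N - K) * (tailPoly H₁ t - 1)) :
    colPoly H s = C ((K : ℝ) / N) * X ^ (N - K) * colPoly H₁ s := by
  have hN0 : (N : ℝ) ≠ 0 := Nat.cast_ne_zero.2 (by omega)
  set S : ℝ[X] := C (((N - K : ℕ) : ℝ)⁻¹) * ∑ i ∈ range (N - K), X ^ i with hS
  have hright : tailPoly H (K + 1) = S := by
    rw [h.tailPoly_right hKN le_rfl, tailPoly_one_of_mem_optimalSet (by omega) opt₂]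
  have hmid : tailPoly H K = C ((K : ℝ) / N) * (X ^ (N - K) - S) + S := by
    rw [tailPoly_eq_add H hKN, hright, h.colPoly_middle (by omega) hKN]
  rw [colPoly_eq H hs, colPoly_eq H₁ hs, mul_left_comm]
  congr 1
  have hsub : Icc s K ⊆ Icc s (N - 1) := Finset.Icc_subset_Icc_right hKN
  rw [← Finset.sum_subset hsub]
  · obtain ⟨L, rfl⟩ : ∃ L, K = L + 1 := ⟨K - 1, by omega⟩
    simp only [Nat.add_sub_cancel] at *
    have hrow : entry H (L + 1) s =
        -(((N : ℝ) - ((L + 1 : ℕ) : ℝ)) / N) * ∑ i ∈ Icc s L, entry H₁ i s := h.row s hs (by omega)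
    rw [Finset.sum_Icc_succ_top (by omega), hrow, hright]
    have h1 : ∀ i ∈ Icc s L, C (entry H i s) * tailPoly H (i + 1) =
        C (entry H₁ i s) * (tailPoly H (L + 1) + C (((L + 1 : ℕ) : ℝ) / N) * X ^ (N - (L + 1)) *
          (tailPoly H₁ (i + 1) - 1)) := by
      intro i hi
      rw [mem_Icc] at hi
      rw [ih (i + 1) (by omega) (by omega), h.block_left i s (by omega) (by omega) hs (by omega)]
    rw [Finset.sum_congr rfl h1, hmid, C_mul, map_sum, Finset.mul_sum, Finset.sum_mul,
      ← Finset.sum_add_distrib, Finset.mul_sum]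
    refine Finset.sum_congr rfl fun i _ => ?_
    have h2 : C (-(((N : ℝ) - ((L + 1 : ℕ) : ℝ)) / N)) = C (((L + 1 : ℕ) : ℝ) / N) - 1 := by
      rw [← C_1, ← C_sub]
      congr 1
      field_simp
      ring
    rw [h2]
    ring
  · intro i hi hi'
    rw [mem_Icc] at hi hi'
    rw [h.block_zero i s (by omega) (by omega) hs (by omega), map_zero, zero_mul]

theorem tailPoly_left (h : IsGluing N K H₁ H₂ H) (hKN : K ≤ N - 1)
    (opt₂ : H₂ ∈ optimalSet.{u} (N - K)) {s : ℕ} (hs : 1 ≤ s) (hsK : s ≤ K) :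
    tailPoly H s = tailPoly H K + C ((K : ℝ) / N) * X ^ (N - K) * (tailPoly H₁ s - 1) := by
  obtain ⟨d, hd⟩ : ∃ d, K ≤ s + d := ⟨K, by omega⟩
  induction d using Nat.strong_induction_on generalizing s with
  | _ d ih =>
    rcases hsK.eq_or_lt with rfl | hlt
    · rw [tailPoly_of_lt H₁ (by omega), sub_self, mul_zero, add_zero]
    · have ih' : ∀ t, s < t → t ≤ K → tailPoly H t =
          tailPoly H K + C ((K : ℝ) / N) * X ^ (N - K) * (tailPoly H₁ t - 1) := fun t ht htK =>
        ih (d - 1) (by omega) (by omega) htK (by omega)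
      rw [tailPoly_eq_add H (by omega), tailPoly_eq_add H₁ (by omega),
        h.colPoly_left_of_tailPoly hKN opt₂ hs hlt ih', ih' (s + 1) (by omega) hlt]
      ring

theorem colPoly_left (h : IsGluing N K H₁ H₂ H) (hKN : K ≤ N - 1)
    (opt₂ : H₂ ∈ optimalSet.{u} (N - K)) {s : ℕ} (hs : 1 ≤ s) (hsK : s < K) :
    colPoly H s = C ((K : ℝ) / N) * X ^ (N - K) * colPoly H₁ s :=
  h.colPoly_left_of_tailPoly hKN opt₂ hs hsK fun _ ht htK =>
    h.tailPoly_left hKN opt₂ (by omega) htK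

end IsGluing

theorem sum_sq_coeff_C_mul_X_pow_mul (c : ℝ) (p : ℝ[X]) {M N : ℕ} (hMN : M ≤ N) :
    ∑ i ∈ range N, (C c * X ^ M * p).coeff i ^ 2 = c ^ 2 * ∑ i ∈ range (N - M), p.coeff i ^ 2 := by
  obtain ⟨K, rfl⟩ := Nat.exists_eq_add_of_le hMN
  rw [Finset.sum_range_add, Nat.add_sub_cancel_left, Finset.mul_sum, Finset.sum_eq_zero, zero_add]
  · refine Finset.sum_congr rfl fun i _ => ?_
    rw [mul_assoc, coeff_C_mul, add_comm, coeff_X_pow_mul, mul_pow]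
  · intro i hi
    rw [mem_range] at hi
    rw [mul_assoc, coeff_C_mul, coeff_X_pow_mul', if_neg (by omega), mul_zero, zero_pow two_ne_zero]

/-- The effect of a gluing on the energy. -/
theorem IsGluing.energy_eq {N K : ℕ} {H₁ : Matrix (Fin (K - 1)) (Fin (K - 1)) ℝ}
    {H₂ : Matrix (Fin (N - K - 1)) (Fin (N - K - 1)) ℝ} {H : Matrix (Fin (N - 1)) (Fin (N - 1)) ℝ}
    (h : IsGluing N K H₁ H₂ H) (hK : 1 ≤ K) (hKN : K ≤ N - 1)
    (opt₂ : H₂ ∈ optimalSet.{u} (N - K)) :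
    energy H = ((K : ℝ) / N) ^ 2 * (energy H₁ + 1 + ((N : ℝ) - K)⁻¹) + energy H₂ := by
  have hM : ((N - K : ℕ) : ℝ) ≠ 0 := Nat.cast_ne_zero.2 (by omega)
  have hcast : ((N - K : ℕ) : ℝ) = (N : ℝ) - K := by rw [Nat.cast_sub (by omega)]
  have hleft : ∑ j ∈ Ico 1 K, ∑ i ∈ range N, (colPoly H j).coeff i ^ 2 =
      ((K : ℝ) / N) ^ 2 * energy H₁ := by
    rw [energy, Finset.mul_sum, show Icc 1 (K - 1) = Ico 1 K by
      ext
      simp only [mem_Icc, mem_Ico]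
      omega]
    refine Finset.sum_congr rfl fun j hj => ?_
    rw [mem_Ico] at hj
    rw [h.colPoly_left hKN opt₂ hj.1 hj.2, sum_sq_coeff_C_mul_X_pow_mul _ _ (by omega),
      show N - (N - K) = K by omega]
  have hmid : ∑ i ∈ range N, (colPoly H K).coeff i ^ 2 =
      ((K : ℝ) / N) ^ 2 * (1 + ((N : ℝ) - K)⁻¹) := by
    have hco : ∀ i, (colPoly H K).coeff i ^ 2 = ((K : ℝ) / N) ^ 2 *
        ((if i = N - K then 1 else 0) + if i < N - K then (((N - K : ℕ) : ℝ)⁻¹) ^ 2 else 0) := by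
      intro i
      rw [h.colPoly_middle hK hKN]
      simp only [coeff_C_mul, coeff_sub, finsetSum_coeff, coeff_X_pow, Finset.sum_ite_eq,
        mem_range, mul_pow]
      congr 1
      rcases lt_trichotomy i (N - K) with hi | hi | hi
      · rw [if_neg hi.ne, if_pos hi, if_pos hi]
        ring
      · rw [if_pos hi, if_neg (by omega), if_neg (by omega)]
        ring
      · rw [if_neg hi.ne', if_neg (by omega), if_neg (by omega)]
        ring
    simp only [hco]
    rw [← Finset.mul_sum, Finset.sum_add_distrib, Finset.sum_ite_eq', if_pos (by
      rw [mem_range]; omega), ← Finset.sum_filter, show (range N).filter (· < N - K) =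
        range (N - K) by
          ext
          simp only [mem_filter, mem_range]
          omega, Finset.sum_const, card_range, nsmul_eq_mul, ← hcast]
    congr 2
    field_simp
  have hright : ∑ j ∈ Ico (K + 1) N, ∑ i ∈ range N, (colPoly H j).coeff i ^ 2 = energy H₂ := by
    rw [energy]
    refine Finset.sum_bij' (fun j _ => j - K) (fun j _ => K + j) ?_ ?_ ?_ ?_ ?_
    all_goals simp only [mem_Icc, mem_Ico]
    all_goals intro j hj
    · omega
    · omega
    · omega
    · omega
    · obtain ⟨s, rfl⟩ := Nat.exists_eq_add_of_le (show K ≤ j by omega)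
      rw [h.colPoly_right hKN (by omega), Nat.add_sub_cancel_left]
      refine (Finset.sum_subset (Finset.range_subset_range.2 (by omega)) fun i _ hi => ?_).symm
      rw [mem_range] at hi
      rw [coeff_colPoly_of_le H₂ s (by omega), zero_pow two_ne_zero]
  rw [energy, show Icc 1 (N - 1) = Ico 1 N by
      ext
      simp only [mem_Icc, mem_Ico]
      omega, ← Finset.sum_Ico_consecutive _ hK (show K ≤ N by omega),
    Finset.sum_eq_sum_Ico_succ_bot (show K < N by omega), hleft, hmid, hright]
  ring

/-! ### Optimality of Halpern's method -/

/-- The method of `ohm N` is Halpern's iteration. -/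
theorem ohm_follows {Y : Type u} [NormedAddCommGroup Y] [InnerProductSpace ℝ Y] {N : ℕ}
    {T : Y → Y} {y : ℕ → Y} (h : Follows (ohm N) T y) {k : ℕ} (hk : k < N - 1) :
    ((k : ℝ) + 2) • (y (k + 1) - y 0) = ((k : ℝ) + 1) • (y k - y 0 - (y k - T (y k))) := by
  have hstep : ∀ k < N - 1, y (k + 1) = y k + (((k : ℝ) + 1) * (k + 2))⁻¹ •
      ∑ j ∈ range k, ((j : ℝ) + 1) • (y j - T (y j)) -
        (((k : ℝ) + 1) / (k + 2)) • (y k - T (y k)) := by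
    intro k hk
    have hlt : ∀ j ∈ range k, entry (ohm N) (k + 1) (j + 1) • (y j - T (y j)) =
        (-(((k : ℝ) + 1) * (k + 2))⁻¹) • ((j : ℝ) + 1) • (y j - T (y j)) := by
      intro j hj
      rw [mem_range] at hj
      rw [entry_succ (ohm N) ⟨k, hk⟩ ⟨j, by omega⟩, smul_smul]
      congr 1
      simp only [ohm, Matrix.of_apply]
      rw [if_pos (by rw [Fin.lt_def]; exact hj)]
      field_simp
      ring
    rw [h k hk, Finset.sum_range_succ, Finset.sum_congr rfl hlt, ← Finset.smul_sum,
      entry_succ (ohm N) ⟨k, hk⟩ ⟨k, hk⟩]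
    have hd : ohm N ⟨k, hk⟩ ⟨k, hk⟩ = ((k : ℝ) + 1) / (k + 2) := by
      simp only [ohm, Matrix.of_apply, lt_irrefl, if_false, if_true]
      ring
    rw [hd, neg_smul]
    abel
  -- Both the matrix and Halpern's iteration give `y_k - y_0` as this weighted sum of residuals.
  have hsum : ∀ k ≤ N - 1, ((k : ℝ) + 1) • (y k - y 0) =
      -∑ j ∈ range k, ((j : ℝ) + 1) • (y j - T (y j)) := by
    intro k hk
    induction k with
    | zero => simp
    | succ k ih =>
      rw [Finset.sum_range_succ, neg_add, ← ih (by omega), hstep k (by omega),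
        ← neg_neg (∑ j ∈ range k, _), ← ih (by omega)]
      push_cast
      have h1 : (k : ℝ) + 1 ≠ 0 := by positivity
      have h2 : (k : ℝ) + 2 ≠ 0 := by positivity
      match_scalars <;> field_simp <;> ring
  have h1 := hsum (k + 1) (by omega)
  rw [Finset.sum_range_succ, neg_add, ← hsum k (by omega)] at h1
  push_cast at h1
  rw [show (k : ℝ) + 2 = k + 1 + 1 by ring, h1]
  module

/-- Nonexpansiveness of `T` as a monotonicity property of `1 - T`. -/
theorem inner_residual_ge {Y : Type u} [NormedAddCommGroup Y] [InnerProductSpace ℝ Y]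
    {T : Y → Y} (hT : ∀ a b : Y, ‖T a - T b‖ ≤ ‖a - b‖) (a b : Y) :
    ‖(a - T a) - (b - T b)‖ ^ 2 ≤ 2 * inner ℝ (a - b) ((a - T a) - (b - T b)) := by
  have h := hT a b
  have h1 : T a - T b = (a - b) - ((a - T a) - (b - T b)) := by abel
  rw [h1] at h
  have h2 := pow_le_pow_left₀ (norm_nonneg _) h 2
  rw [norm_sub_sq_real] at h2
  linarith

/-- One step of Halpern's iteration does not destroy the sign of the potential
`⟨g_k, y_k - y_0⟩ + (k / 2) ‖g_k‖²`, here for `d = y_k - y_0`, `d' = y_{k+1} - y_0`. -/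
theorem halpern_potential_step {Y : Type u} [NormedAddCommGroup Y] [InnerProductSpace ℝ Y]
    {k : ℝ} (hk : 0 ≤ k) {d d' g g' : Y} (hd : (k + 2) • d' = (k + 1) • (d - g))
    (hmono : ‖g' - g‖ ^ 2 ≤ 2 * inner ℝ (d' - d) (g' - g))
    (h : inner ℝ g d + k / 2 * ‖g‖ ^ 2 ≤ 0) :
    inner ℝ g' d' + (k + 1) / 2 * ‖g'‖ ^ 2 ≤ 0 := by
  have e1 := congrArg (fun v => inner ℝ v g) hd
  have e2 := congrArg (fun v => inner ℝ v g') hd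
  simp only [inner_smul_left, inner_sub_left, conj_trivial, real_inner_self_eq_norm_sq] at e1 e2
  rw [norm_sub_sq_real] at hmono
  simp only [inner_sub_left, inner_sub_right] at hmono
  rw [real_inner_comm d g] at h
  rw [real_inner_comm d' g']
  rw [real_inner_comm g g'] at hmono
  -- `k + 2` times the new potential is at most `k + 1` times the old one; the difference is
  -- `(k + 1) (k + 2) / 2` times the slack in `hmono`.
  have p1 := mul_nonpos_of_nonneg_of_nonpos (show 0 ≤ k + 1 by linarith) h
  have p2 := mul_le_mul_of_nonneg_left hmono (show 0 ≤ (k + 1) * (k + 2) / 2 by positivity)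
  refine nonpos_of_mul_nonpos_right (a := k + 2) ?_ (by linarith)
  linear_combination p1 + p2 - (k + 1) * e1 + (k + 2) * e2

theorem ohm_isLowerTriangular (N : ℕ) : IsLowerTriangular (ohm N) := by
  intro i j hij
  simp only [ohm, Matrix.of_apply]
  rw [if_neg hij.not_gt, if_neg hij.ne']

theorem ohm_mem_optimalSet (N : ℕ) (hN : 1 ≤ N) : ohm N ∈ optimalSet.{u} N := by
  refine ⟨ohm_isLowerTriangular N, fun Y _ _ _ T hT ystar hstar y hy => ?_⟩
  have hpot : ∀ k ≤ N - 1, inner ℝ (y k - T (y k)) (y k - y 0) +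
      (k : ℝ) / 2 * ‖y k - T (y k)‖ ^ 2 ≤ 0 := by
    intro k hk
    induction k with
    | zero => simp
    | succ k ih =>
      push_cast
      refine halpern_potential_step (Nat.cast_nonneg k) (ohm_follows hy hk) ?_ (ih (by omega))
      simpa using inner_residual_ge hT (y (k + 1)) (y k)
  have h1 := hpot (N - 1) le_rfl
  have h2 := inner_residual_ge hT (y (N - 1)) ystar
  rw [hstar, sub_self, sub_zero, real_inner_comm] at h2
  set g := y (N - 1) - T (y (N - 1))
  have h3 : y (N - 1) - ystar = (y (N - 1) - y 0) + (y 0 - ystar) := by abel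
  rw [h3, inner_add_right] at h2
  have h4 := real_inner_le_norm g (y 0 - ystar)
  rw [Nat.cast_sub hN, Nat.cast_one] at h1
  have hN' : (0 : ℝ) < N := by positivity
  have h5 : (N : ℝ) * ‖g‖ ≤ 2 * ‖y 0 - ystar‖ := by
    rcases (norm_nonneg g).eq_or_lt with h0 | h0
    · rw [← h0, mul_zero]
      positivity
    · refine le_of_mul_le_mul_right ?_ h0
      nlinarith
  rw [le_div_iff₀ (by positivity)]
  have := pow_le_pow_left₀ (by positivity) h5 2
  nlinarith

/-! ### The certificates of Halpern's method and the energy of basic matrices -/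

theorem entry_ohm {N k j : ℕ} (hj : 1 ≤ j) (hjk : j ≤ k) (hk : k ≤ N - 1) :
    entry (ohm N) k j =
      if j < k then -((j : ℝ) / ((k : ℝ) * (k + 1))) else (k : ℝ) / ((k : ℝ) + 1) := by
  obtain ⟨a, rfl⟩ := Nat.exists_eq_add_of_le' (hj.trans hjk)
  obtain ⟨b, rfl⟩ := Nat.exists_eq_add_of_le' hj
  rw [entry_succ (ohm N) ⟨a, by omega⟩ ⟨b, by omega⟩]
  simp only [ohm, Matrix.of_apply, Fin.lt_def, Fin.ext_iff]
  push_cast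
  rcases lt_or_ge b a with h | h
  · rw [if_pos h, if_pos (by omega)]
  · rw [if_neg (by omega), if_pos (by omega), if_neg (by omega)]

theorem sum_entry_ohm {N j : ℕ} (hj : 1 ≤ j) (m : ℕ) (hjm : j ≤ m) (hm : m ≤ N - 1) :
    ∑ k ∈ Icc j m, entry (ohm N) k j = (j : ℝ) / ((m : ℝ) + 1) := by
  induction m, hjm using Nat.le_induction with
  | base => rw [Icc_self, sum_singleton, entry_ohm hj le_rfl hm, if_neg (lt_irrefl _)]
  | succ m hjm ih =>
    rw [Finset.sum_Icc_succ_top (by omega), ih (by omega), entry_ohm hj (by omega) hm,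
      if_pos (by omega)]
    push_cast
    field_simp
    ring

/-- The matrix of the Optimal Halpern Method is its predecessor glued to the empty matrix. -/
theorem ohm_isGluing {N : ℕ} (hN : 2 ≤ N) :
    IsGluing N (N - 1) (ohm (N - 1)) (ohm (N - (N - 1))) (ohm N) := by
  obtain ⟨K, rfl⟩ : ∃ K, N = K + 1 := ⟨N - 1, by omega⟩
  have hdiag : entry (ohm (K + 1)) K K = (K : ℝ) / ((K : ℝ) + 1) := by
    rw [entry_ohm (by omega) le_rfl (by omega), if_neg (lt_irrefl _)]
  change IsGluing (K + 1) K (ohm K) (ohm (K + 1 - K)) (ohm (K + 1))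
  refine ⟨ohm_isLowerTriangular (K + 1), ?_, ?_, ?_, ?_, ?_, ?_⟩
  · intro k j hk hkK hj hjK
    rcases le_or_gt j k with h | h
    · rw [entry_ohm hj h (by omega), entry_ohm hj h (by omega)]
    · obtain ⟨a, rfl⟩ := Nat.exists_eq_add_of_le' hk
      obtain ⟨b, rfl⟩ := Nat.exists_eq_add_of_le' hj
      have h1 := ohm_isLowerTriangular (K + 1) ⟨a, by omega⟩ ⟨b, by omega⟩
        (by rw [Fin.lt_def]; simp only; omega)
      have h2 := ohm_isLowerTriangular K ⟨a, by omega⟩ ⟨b, by omega⟩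
        (by rw [Fin.lt_def]; simp only; omega)
      rw [entry_succ (ohm (K + 1)) ⟨a, by omega⟩ ⟨b, by omega⟩, h1,
        entry_succ (ohm K) ⟨a, by omega⟩ ⟨b, by omega⟩, h2]
  · intro k j
    omega
  · intro k j
    omega
  · intro j hj hjK
    rw [entry_ohm hj (by omega) (by omega), if_pos (by omega),
      sum_entry_ohm hj (K - 1) hjK le_rfl, Nat.cast_sub (by omega)]
    have : (K : ℝ) ≠ 0 := Nat.cast_ne_zero.2 (by omega)
    have hK : (K : ℝ) - 1 + 1 = K := by ring
    push_cast
    rw [hK]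
    field_simp
    ring
  · rw [hdiag]
    push_cast
    field_simp
    ring
  · intro k hk hkK
    obtain rfl : k = 1 := by omega
    have hQ : Q (ohm (K + 1)) 1 K = (K : ℝ) / ((K : ℝ) + 1) := by
      have h1 := Q_succ (ohm (K + 1)) 0 K (by omega)
      have h2 : Icc K (K + 1 - 1) = {K} := by rw [Nat.add_sub_cancel, Icc_self]
      rw [h2, sum_singleton, hdiag, if_pos rfl, mul_one] at h1
      exact h1
    rw [hQ]
    simp
    field_simp

theorem ohm_isBasic (N : ℕ) (hN : 1 ≤ N) : IsBasic.{u} N (ohm N) := by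
  induction N, hN using Nat.le_induction with
  | base => exact IsBasic.empty _
  | succ N hN ih =>
    have h1 : ∀ M, M = 1 → IsBasic.{u} M (ohm M) := by
      rintro M rfl
      exact IsBasic.empty _
    exact IsBasic.glue (N + 1) (N + 1 - 1) (by omega) le_rfl _ _ _
      (ohm_mem_optimalSet _ (by omega)) (ohm_mem_optimalSet _ (by omega)) ih
      (h1 _ (by omega)) (ohm_isGluing (by omega))

theorem colPoly_ohm {N j : ℕ} (hj : 1 ≤ j) (hjN : j < N) :
    colPoly (ohm N) j = C ((j : ℝ) / N) * X ^ (N - 1 - j) * (X - 1) := by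
  obtain ⟨d, rfl⟩ := Nat.exists_eq_add_of_lt hjN
  have hN : (j + d + 1) - (j + d) = 1 := by omega
  have hg : IsGluing (j + d + 1) (j + d) (ohm (j + d)) _ (ohm (j + d + 1)) :=
    ohm_isGluing (N := j + d + 1) (by omega)
  induction d with
  | zero =>
    simp only [Nat.add_zero] at *
    rw [hg.colPoly_middle hj le_rfl, hN]
    simp
  | succ d ih =>
    have hopt : ohm (j + (d + 1) + 1 - (j + (d + 1))) ∈
        optimalSet.{0} (j + (d + 1) + 1 - (j + (d + 1))) := ohm_mem_optimalSet _ (by omega)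
    have hd : colPoly (ohm (j + (d + 1))) j = _ :=
      ih (by omega) (by omega) (ohm_isGluing (N := j + d + 1) (by omega))
    rw [hg.colPoly_left (by omega) hopt hj (by omega), hd, hN]
    have h1 : j + (d + 1) + 1 - 1 - j = d + 1 := by omega
    have h2 : j + d + 1 - 1 - j = d := by omega
    rw [h1, h2, show C ((j : ℝ) / ((j + (d + 1) + 1 : ℕ) : ℝ)) =
      C (((j + (d + 1) : ℕ) : ℝ) / ((j + (d + 1) + 1 : ℕ) : ℝ)) *
        C ((j : ℝ) / ((j + d + 1 : ℕ) : ℝ)) by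
        rw [← C_mul]
        congr 1
        push_cast
        field_simp
        ring]
    ring

/-- Only the certificates next to the diagonal survive: the coefficient vectors of columns `j` and
`k` are multiples of `e_{N-j} - e_{N-j-1}` and `e_{N-k} - e_{N-k-1}` (or `e_0`, for `k = N`). -/
theorem certificate_ohm {N k j : ℕ} (hj : 1 ≤ j) (hjk : j < k) (hk : k ≤ N) :
    certificate (ohm N) k j = if k = j + 1 then (j : ℝ) * (j + 1) / N else 0 := by
  have hN : (N : ℝ) ≠ 0 := Nat.cast_ne_zero.2 (by omega)
  have hcol : ∀ j, 1 ≤ j → j < N → ∀ i, (colPoly (ohm N) j).coeff i =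
      (j : ℝ) / N * ((if i = N - j then 1 else 0) - if i = N - 1 - j then 1 else 0) := by
    intro j hj hjN i
    rw [colPoly_ohm hj hjN, mul_assoc, coeff_C_mul, mul_sub, mul_one, ← pow_succ, coeff_sub,
      coeff_X_pow, coeff_X_pow, show N - 1 - j + 1 = N - j by omega]
  rw [certificate_eq _ hjk hk, certPoly, if_neg (by omega)]
  have hsum : ∑ i ∈ range N, (colPoly (ohm N) j).coeff i * (certPoly (ohm N) k).coeff i =
      (j : ℝ) / N * ((certPoly (ohm N) k).coeff (N - j) -
        (certPoly (ohm N) k).coeff (N - 1 - j)) := by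
    simp only [hcol j hj (by omega), mul_assoc, ← Finset.mul_sum, sub_mul, ite_mul, one_mul,
      zero_mul, Finset.sum_sub_distrib, Finset.sum_ite_eq', mem_range]
    rw [if_pos (by omega), if_pos (by omega)]
  rw [hsum]
  rcases hk.eq_or_lt with rfl | hkN
  · rw [certPoly, if_pos rfl, coeff_one, coeff_one, if_neg (by omega)]
    by_cases h : k = j + 1
    · rw [if_pos (by omega), if_pos h, h]
      push_cast
      field_simp
      ring
    · rw [if_neg (by omega), if_neg h]
      ring
  · rw [certPoly, if_neg (by omega), hcol k (by omega) hkN, hcol k (by omega) hkN,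
      if_neg (by omega), if_neg (by omega), if_neg (by omega : ¬ N - 1 - j = N - 1 - k)]
    by_cases h : k = j + 1
    · rw [if_pos (by omega), if_pos h, h]
      push_cast
      field_simp
      ring
    · rw [if_neg (by omega), if_neg h]
      ring

theorem rho_ohm (N : ℕ) :
    rho (ohm N) = ∑ j ∈ Icc 1 (N - 1), certificate (ohm N) (j + 1) j := by
  refine Finset.sum_congr rfl fun j hj => ?_
  rw [mem_Icc] at hj
  refine Finset.sum_eq_single_of_mem (j + 1) (mem_Icc.2 (by omega)) fun k hk hkj => ?_
  rw [mem_Icc] at hk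
  rw [certificate_ohm hj.1 (by omega) hk.2, if_neg hkj]

theorem rho_ohm_eq {N : ℕ} (hN : 1 ≤ N) : rho (ohm N) = ((N : ℝ) ^ 2 - 1) / 3 := by
  have h : ∀ n : ℕ, ∑ j ∈ Icc 1 n, ((j : ℝ) * (j + 1)) = (n : ℝ) * (n + 1) * (n + 2) / 3 := by
    intro n
    induction n with
    | zero => simp
    | succ n ih =>
      rw [Finset.sum_Icc_succ_top (by omega), ih]
      push_cast
      ring
  have h1 : ∀ j ∈ Icc 1 (N - 1), certificate (ohm N) (j + 1) j = (j : ℝ) * (j + 1) / N := by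
    intro j hj
    rw [mem_Icc] at hj
    rw [certificate_ohm hj.1 (by omega) (by omega), if_pos rfl]
  rw [rho_ohm, Finset.sum_congr rfl h1, ← Finset.sum_div, h, Nat.cast_sub hN]
  have : (N : ℝ) ≠ 0 := Nat.cast_ne_zero.2 (by omega)
  push_cast
  field_simp
  ring

/-- A gluing with an empty second block is determined by its first block. -/
theorem IsGluing.eq_of_pred {N K : ℕ} {H₁ : Matrix (Fin (K - 1)) (Fin (K - 1)) ℝ}
    {H₂ H₂' : Matrix (Fin (N - K - 1)) (Fin (N - K - 1)) ℝ}
    {H H' : Matrix (Fin (N - 1)) (Fin (N - 1)) ℝ} (h : IsGluing N K H₁ H₂ H)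
    (h' : IsGluing N K H₁ H₂' H') (hK : K = N - 1) : H = H' := by
  refine matrix_ext_entry fun k j hk hkN hj hjN => ?_
  rcases lt_or_ge k j with hkj | hkj
  · obtain ⟨a, rfl⟩ := Nat.exists_eq_add_of_le' hk
    obtain ⟨b, rfl⟩ := Nat.exists_eq_add_of_le' hj
    have hab : (⟨a, by omega⟩ : Fin (N - 1)) < ⟨b, by omega⟩ := by
      rw [Fin.lt_def]
      simp only
      omega
    rw [entry_succ H ⟨a, by omega⟩ ⟨b, by omega⟩, entry_succ H' ⟨a, by omega⟩ ⟨b, by omega⟩,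
      h.lower _ _ hab, h'.lower _ _ hab]
  · rcases lt_or_ge k K with hlt | hge
    · rw [h.block_left k j hk (by omega) hj (by omega),
        h'.block_left k j hk (by omega) hj (by omega)]
    · obtain rfl : k = K := by omega
      rcases hkj.eq_or_lt with rfl | hjk
      · rw [h.diag, h'.diag]
      · rw [h.row j hj (by omega), h'.row j hj (by omega)]

/-- The loss in the energy bound when sizes `a` and `M` are glued. -/
theorem energy_bound_identity {a M : ℝ} (ha : 0 < a) (hM : 0 < M) :
    (2 * (a + M) - 1) * (a + M - 1) / (3 * (a + M)) -
      ((a / (a + M)) ^ 2 * ((2 * a - 1) * (a - 1) / (3 * a) + 1 + M⁻¹) +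
        (2 * M - 1) * (M - 1) / (3 * M)) =
      2 * a * (2 * a + M) * (M ^ 2 - 1) / (3 * M * (a + M) ^ 2) := by
  have : a + M ≠ 0 := by positivity
  field_simp
  ring

/-- Among basic matrices the energy is largest for the Optimal Halpern Method: the recursion for
gluings loses a positive multiple of `M ^ 2 - 1`, where `M = N - N'`, so that every gluing has to
have an empty second block. -/
theorem IsBasic.energy_le {N : ℕ} {H : Matrix (Fin (N - 1)) (Fin (N - 1)) ℝ}
    (h : IsBasic.{u} N H) :
    energy H ≤ (2 * (N : ℝ) - 1) * (N - 1) / (3 * N) ∧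
      (energy H = (2 * (N : ℝ) - 1) * (N - 1) / (3 * N) → H = ohm N) := by
  induction h with
  | empty H =>
    refine ⟨by simp [energy], fun _ => ?_⟩
    ext i
    exact absurd i.2 (by omega)
  | glue N K hK hKN H₁ H₂ H opt₁ opt₂ basic₁ basic₂ gluing ih₁ ih₂ =>
    have hM : 1 ≤ N - K := by omega
    have hcast : ((N - K : ℕ) : ℝ) = (N : ℝ) - K := by rw [Nat.cast_sub (by omega)]
    have hK' : (0 : ℝ) < K := Nat.cast_pos.2 hK
    have hM' : (1 : ℝ) ≤ ((N - K : ℕ) : ℝ) := by exact_mod_cast hM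
    have hNK : (N : ℝ) = K + ((N - K : ℕ) : ℝ) := by rw [hcast]; ring
    have hE := gluing.energy_eq hK hKN opt₂
    have hid := energy_bound_identity hK' (show (0 : ℝ) < ((N - K : ℕ) : ℝ) by linarith)
    rw [← hNK] at hid
    rw [← hcast] at hE
    have hN : (0 : ℝ) < N := by linarith
    have hc : 0 < ((K : ℝ) / N) ^ 2 := by positivity
    have hloss : 0 ≤ 2 * (K : ℝ) * (2 * K + ((N - K : ℕ) : ℝ)) * (((N - K : ℕ) : ℝ) ^ 2 - 1) /
        (3 * ((N - K : ℕ) : ℝ) * (N : ℝ) ^ 2) := by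
      have : 0 ≤ ((N - K : ℕ) : ℝ) ^ 2 - 1 := by nlinarith
      positivity
    have h1 := mul_le_mul_of_nonneg_left ih₁.1 hc.le
    have h2 := ih₂.1
    refine ⟨by linarith, fun heq => ?_⟩
    have hloss0 : 2 * (K : ℝ) * (2 * K + ((N - K : ℕ) : ℝ)) * (((N - K : ℕ) : ℝ) ^ 2 - 1) /
        (3 * ((N - K : ℕ) : ℝ) * (N : ℝ) ^ 2) = 0 := by linarith
    have hM1 : ((N - K : ℕ) : ℝ) = 1 := by
      have h3 : ((N - K : ℕ) : ℝ) ^ 2 - 1 = 0 := by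
        have h4 : (2 * (K : ℝ) * (2 * K + ((N - K : ℕ) : ℝ))) ≠ 0 := by positivity
        have h5 : (3 * ((N - K : ℕ) : ℝ) * (N : ℝ) ^ 2) ≠ 0 := by positivity
        exact (mul_eq_zero.1 ((div_eq_zero_iff.1 hloss0).resolve_right h5)).resolve_left h4
      nlinarith
    have hE1 : ((K : ℝ) / N) ^ 2 * energy H₁ =
        ((K : ℝ) / N) ^ 2 * ((2 * (K : ℝ) - 1) * (K - 1) / (3 * K)) := by linarith
    have hH1 := ih₁.2 (mul_left_cancel₀ hc.ne' hE1)
    have hKpred : K = N - 1 := by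
      have : N - K = 1 := by exact_mod_cast hM1
      omega
    subst hKpred
    subst hH1
    exact gluing.eq_of_pred (ohm_isGluing (by omega)) rfl

/-! ### Nonzero certificates of optimal matrices -/

/-- Each column, added to the columns on its right, raises the degree by at most one. -/
theorem natDegree_tailPoly_le (H : Matrix (Fin n) (Fin n) ℝ) {s D : ℕ}
    (h : ∀ k, s < k → (tailPoly H k).natDegree ≤ D) (t : ℕ) :
    ∀ k, 1 ≤ k → s < k + t → (tailPoly H k).natDegree ≤ D + t := by
  induction t with
  | zero => exact fun k _ hk => h k hk
  | succ t ih =>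
    intro k hk1 hk
    rcases lt_or_ge n k with hnk | hkn
    · rw [tailPoly_of_lt H hnk, natDegree_one]
      omega
    · rw [tailPoly_eq_add H hkn]
      refine natDegree_add_le_of_degree_le ?_ ((ih (k + 1) (by omega) (by omega)).trans (by omega))
      rw [colPoly_eq H hk1]
      refine natDegree_mul_le.trans ?_
      rw [show ((X : ℝ[X]) - 1).natDegree = 1 from natDegree_X_sub_C 1, add_comm, ← add_assoc]
      refine Nat.add_le_add_right (natDegree_sum_le_of_forall_le _ _ fun i hi => ?_) 1
      rw [mem_Icc] at hi
      exact (natDegree_C_mul_le _ _).trans (ih (i + 1) (by omega) (by omega))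

/-- If all certificates of column `j` vanish, then so does the generating polynomial `p` of that
column: `p = (X - 1) u` with `p` orthogonal to `u`, so that `‖p‖² = ‖X u‖² - ‖u‖² ≤ 0`, where the
coefficient vectors are cut off in degree `N`. -/
theorem colPoly_eq_zero_of_certificate {N j : ℕ} (hj : 1 ≤ j) (hjN : j ≤ N - 1)
    (H : Matrix (Fin (N - 1)) (Fin (N - 1)) ℝ)
    (h : ∀ k, j < k → k ≤ N → certificate H k j = 0) : colPoly H j = 0 := by
  have hN : (N : ℝ) ≠ 0 := Nat.cast_ne_zero.2 (by omega)
  have hcert : ∀ k, j < k → k ≤ N →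
      ∑ i ∈ range N, (colPoly H j).coeff i * (certPoly H k).coeff i = 0 := by
    intro k hjk hk
    have := h k hjk hk
    rw [certificate_eq H hjk hk, certPoly, if_neg (by omega)] at this
    exact (mul_eq_zero.1 this).resolve_left (neg_ne_zero.2 hN)
  have htail : ∀ k, j < k →
      ∑ i ∈ range N, (colPoly H j).coeff i * (tailPoly H k).coeff i = 0 := by
    intro k hk
    simp only [tailPoly, coeff_add, finsetSum_coeff, mul_add, Finset.sum_add_distrib,
      Finset.mul_sum]
    rw [Finset.sum_comm, Finset.sum_eq_zero (s := Icc k (N - 1)), add_zero]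
    · have := hcert N (by omega) le_rfl
      rwa [certPoly, if_pos rfl] at this
    · intro l hl
      rw [mem_Icc] at hl
      have := hcert l (by omega) (by omega)
      rwa [certPoly, if_neg (by omega)] at this
  set u : ℝ[X] := ∑ i ∈ Icc j (N - 1), C (entry H i j) * tailPoly H (i + 1) with hu
  have horth : ∑ i ∈ range N, (colPoly H j).coeff i * u.coeff i = 0 := by
    simp only [hu, finsetSum_coeff, coeff_C_mul, Finset.mul_sum]
    rw [Finset.sum_comm]
    refine Finset.sum_eq_zero fun k hk => ?_
    rw [mem_Icc] at hk
    have := htail (k + 1) (by omega)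
    simp only [mul_left_comm _ (entry H k j), ← Finset.mul_sum, this, mul_zero]
  have hcol : colPoly H j = X * u - u := by
    rw [colPoly_eq H hj]
    ring
  have hco : ∀ i, (colPoly H j).coeff i = (X * u).coeff i - (X * u).coeff (i + 1) := by
    intro i
    rw [hcol, coeff_sub, coeff_X_mul]
  have hsq : ∑ i ∈ range N, (colPoly H j).coeff i ^ 2 ≤ 0 := by
    have h1 : ∀ i ∈ range N, (colPoly H j).coeff i ^ 2 =
        -((X * u).coeff (i + 1) ^ 2 - (X * u).coeff i ^ 2) -
          2 * ((colPoly H j).coeff i * u.coeff i) := by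
      intro i _
      rw [← coeff_X_mul u i, hco]
      ring
    have h2 : ∑ i ∈ range N, ((X * u).coeff (i + 1) ^ 2 - (X * u).coeff i ^ 2) =
        (X * u).coeff N ^ 2 - (X * u).coeff 0 ^ 2 :=
      Finset.sum_range_sub (fun i => (X * u).coeff i ^ 2) N
    rw [Finset.sum_congr rfl h1, Finset.sum_sub_distrib, ← Finset.mul_sum, horth,
      Finset.sum_neg_distrib, h2, coeff_X_mul_zero]
    nlinarith [sq_nonneg ((X * u).coeff N)]
  have hall := (Finset.sum_eq_zero_iff_of_nonneg fun i _ => sq_nonneg _).1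
    (le_antisymm hsq (Finset.sum_nonneg fun i _ => sq_nonneg _))
  ext i
  rcases lt_or_ge i N with hi | hi
  · simpa using hall i (mem_range.2 hi)
  · rw [coeff_colPoly_of_le H j (by omega), coeff_zero]

/-- At an optimal matrix, every column has a nonzero certificate. Otherwise the column would not
contribute to the sum of the generating polynomials, whose degree would be less than `N - 1`. -/
theorem exists_certificate_ne_zero {N j : ℕ} (hj : 1 ≤ j) (hjN : j ≤ N - 1)
    {H : Matrix (Fin (N - 1)) (Fin (N - 1)) ℝ} (hH : H ∈ optimalSet.{u} N) :
    ∃ k, j < k ∧ k ≤ N ∧ certificate H k j ≠ 0 := by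
  by_contra! hcon
  have hzero := colPoly_eq_zero_of_certificate hj hjN H hcon
  have h1 : ∀ k, j < k → (tailPoly H k).natDegree ≤ N - 1 - j := by
    intro k hk
    have := natDegree_tailPoly_le H (s := N - 1) (D := 0)
      (fun k hk => by rw [tailPoly_of_lt H hk, natDegree_one]) (N - 1 - j) k (by omega) (by omega)
    omega
  -- Column `j` adds nothing to the degree, so the count of columns falls short by one.
  have h2 : ∀ k, j - 1 < k → (tailPoly H k).natDegree ≤ N - 1 - j := by
    intro k hk
    rcases (show j ≤ k by omega).eq_or_lt with rfl | hlt
    · rw [tailPoly_eq_add H hjN, hzero, zero_add]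
      exact h1 _ (Nat.lt_succ_self _)
    · exact h1 k hlt
  have h3 := natDegree_tailPoly_le H h2 (j - 1) 1 le_rfl (by omega)
  have h4 : (tailPoly H 1).coeff (N - 1) = 0 := coeff_eq_zero_of_natDegree_lt (by omega)
  rw [tailPoly_one_of_mem_optimalSet (by omega) hH, coeff_C_mul, finsetSum_coeff] at h4
  simp only [coeff_X_pow] at h4
  rw [Finset.sum_ite_eq, if_pos (mem_range.2 (by omega)), mul_one] at h4
  exact inv_ne_zero (Nat.cast_ne_zero.2 (by omega)) h4

/-- Exactly the `N - 1` certificates next to the diagonal are nonzero for `ohm N`, and no optimal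
matrix has fewer nonzero certificates. -/
theorem ohm_isVertex {N : ℕ} (hN : 1 ≤ N) : IsVertex.{u} (ohm N) := by
  refine ⟨ohm_mem_optimalSet N hN, fun H' hH' => ?_⟩
  set P : Set (ℕ × ℕ) := {p | 1 ≤ p.2 ∧ p.2 < p.1 ∧ p.1 ≤ N} with hP
  have hPfin : P.Finite := by
    refine ((Finset.range (N + 1) ×ˢ Finset.range (N + 1)).finite_toSet).subset fun p hp => ?_
    simp only [hP, Set.mem_ofPred_eq] at hp
    simp only [coe_product, Set.mem_prod, Finset.mem_coe, mem_range]
    omega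
  have hsub : ∀ H : Matrix (Fin (N - 1)) (Fin (N - 1)) ℝ, zeroCertificates H ⊆ P :=
    fun H p hp => ⟨hp.1, hp.2.1, hp.2.2.1⟩
  have hcount : ∀ H : Matrix (Fin (N - 1)) (Fin (N - 1)) ℝ,
      (P \ zeroCertificates H).ncard + (zeroCertificates H).ncard = P.ncard :=
    fun H => Set.ncard_sdiff_add_ncard_of_subset (hsub H) hPfin
  have hohm : (P \ zeroCertificates (ohm N)).ncard ≤ N - 1 := by
    have h1 : P \ zeroCertificates (ohm N) ⊆
        ((Icc 1 (N - 1)).image fun j => (j + 1, j) : Finset (ℕ × ℕ)) := by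
      rintro ⟨k, j⟩ ⟨⟨hj, hjk, hk⟩, hnz⟩
      simp only at hj hjk hk
      have : k = j + 1 := by
        by_contra hne
        exact hnz ⟨hj, hjk, hk, by rw [certificate_ohm hj hjk hk, if_neg hne]⟩
      simp only [coe_image, Set.mem_image, Finset.mem_coe, mem_Icc]
      exact ⟨j, by omega, by rw [this]⟩
    refine (Set.ncard_le_ncard h1 (Finset.finite_toSet _)).trans ?_
    rw [Set.ncard_coe_finset]
    exact card_image_le.trans (by simp)
  have hother : N - 1 ≤ (P \ zeroCertificates H').ncard := by
    have h1 : ∀ j, ∃ k, 1 ≤ j → j ≤ N - 1 → j < k ∧ k ≤ N ∧ certificate H' k j ≠ 0 := by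
      intro j
      by_cases hj : 1 ≤ j ∧ j ≤ N - 1
      · obtain ⟨k, hk⟩ := exists_certificate_ne_zero hj.1 hj.2 hH'
        exact ⟨k, fun _ _ => hk⟩
      · exact ⟨0, fun h h' => absurd ⟨h, h'⟩ hj⟩
    choose f hf using h1
    have h2 : (((Icc 1 (N - 1)).image fun j => (f j, j) : Finset (ℕ × ℕ)) : Set (ℕ × ℕ)) ⊆
        P \ zeroCertificates H' := by
      intro p hp
      simp only [coe_image, Set.mem_image, Finset.mem_coe, mem_Icc] at hp
      obtain ⟨j, hj, rfl⟩ := hp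
      have := hf j hj.1 hj.2
      exact ⟨⟨hj.1, this.1, this.2.1⟩, fun h => this.2.2 h.2.2.2⟩
    have h3 := Set.ncard_le_ncard h2 (hPfin.sdiff)
    rw [Set.ncard_coe_finset, card_image_of_injective _ fun a b h => (Prod.mk.inj h).2,
      Nat.card_Icc] at h3
    omega
  have e1 := hcount (ohm N)
  have e2 := hcount H'
  omega

end OptimalFixedPoint

end

theorem mainTheorem10 (N : ℕ) (hN : 2 ≤ N) :
    OptimalFixedPoint.rho (OptimalFixedPoint.ohm N) =
        ∑ j ∈ Finset.Icc 1 (N - 1),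
          OptimalFixedPoint.certificate (OptimalFixedPoint.ohm N) (j + 1) j ∧
      OptimalFixedPoint.rho (OptimalFixedPoint.ohm N) = ((N : ℝ) ^ 2 - 1) / 3 ∧
      OptimalFixedPoint.ohm N ∈ OptimalFixedPoint.basicOptimalVertices.{u} N ∧
      ∀ H ∈ OptimalFixedPoint.basicOptimalVertices.{u} N,
        OptimalFixedPoint.rho H ≤ OptimalFixedPoint.rho (OptimalFixedPoint.ohm N) ∧
        (OptimalFixedPoint.rho H = OptimalFixedPoint.rho (OptimalFixedPoint.ohm N) →
          H = OptimalFixedPoint.ohm N) := by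
  have hN1 : 1 ≤ N := by omega
  have hpos : (0 : ℝ) < N := Nat.cast_pos.2 hN1
  refine ⟨OptimalFixedPoint.rho_ohm N, OptimalFixedPoint.rho_ohm_eq hN1,
    ⟨OptimalFixedPoint.ohm_mem_optimalSet N hN1, OptimalFixedPoint.ohm_isVertex hN1,
      OptimalFixedPoint.ohm_isBasic N hN1⟩, fun H hH => ?_⟩
  obtain ⟨hle, huniq⟩ := hH.2.2.energy_le
  have hbound : ((N : ℝ) * ((2 * (N : ℝ) - 1) * (N - 1) / (3 * N) + 1) - 1) / 2 =
      ((N : ℝ) ^ 2 - 1) / 3 := by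
    field_simp
    ring
  rw [OptimalFixedPoint.rho_ohm_eq hN1, OptimalFixedPoint.rho_eq hN1 hH.1, ← hbound]
  refine ⟨?_, fun heq => huniq (mul_left_cancel₀ hpos.ne' (by linarith))⟩
  have := mul_le_mul_of_nonneg_left hle hpos.le
  linarith
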